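/- Let $\mathbb{H}=\mathbb{R}^3$ with Lebesgue measure $dx\,dy\,dz=r\,dr\,d\theta\,dz$ (cylindric coordinates $x=r\cos\theta$, $y=r\sin\theta$), and let $$X=\partial_x-\tfrac{y}{2}\partial_z,\qquad Y=\partial_y+\tfrac{x}{2}\partial_z,\qquad L=X^2+Y^2 .$$ Let $P_t=e^{tL}$, $t\ge 0$, be the heat semigroup of the Heisenberg group: for $f\in C_c^\infty(\mathbb{H})$, $(t,\mathbf{x})\mapsto P_tf(\mathbf{x})$ is the unique bounded function, continuous on $[0,\infty)\times\mathbb{H}$, $C^2$ in $\mathbf{x}$ and differentiable in $t$ for $t>0$, that solves $\partial_tu=Lu$ for $t>0$ with $u(0,\cdot)=f$. Its kernel at the origin is $$p_t(r,z)=\frac{1}{8\pi^2}\int_{-\infty}^{+\infty}e^{i\lambda z}\,\frac{\lambda}{\sinh\lambda t}\,e^{-\frac{r^2}{4}\lambda\coth\lambda t}\,d\lambda ,\qquad P_tf(0)=\int_{\mathbb{H}}p_t(r,z)\,f\;r\,dr\,d\theta\,dz\quad(t>0).$$ For $t>0$ and $r\ge 0$ let $p^*_t(r,\cdot)$ be the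 unique meromorphic function on the strip $\{w\in\mathbb{C}:|\mathrm{Im}\,w|<\frac{r^2}{4}+3t\}$, analytic on this strip except at $-i(t+\frac{r^2}{4})$, such that $$p^*_t(r,z)=p_t(r,z)-\frac{1}{4\pi^2\left(t+iz+\frac{r^2}{4}\right)^2}\qquad\text{for } z\in\mathbb{R}$$ (so that the pole of the meromorphic continuation of $p_t(r,\cdot)$ at $i(t+\frac{r^2}{4})$ is cancelled). These objects are well defined as described. Moreover, if $f:\mathbb{H}\to\mathbb{R}$ is smooth with compact support, then for every $t>0$ the function $(r,\theta,z)\mapsto p^*_t(r,z+2it)\,(X+iY)f(r,\theta,z)$ is integrable on $\mathbb{H}$ and $$(X+iY)P_tf(0)=\int_{\mathbb{H}}p^*_t(r,z+2it)\,(X+iY)f(r,\theta,z)\;r\,dr\,d\theta\,dz .$$ -/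

import Mathlib

open scoped ContDiff

/-- The Heisenberg group in the coordinates `(x, y, z)` of its Lie algebra, with underlying
space `ℝ³` and Lebesgue measure `dx dy dz` (in cylindric coordinates: `r dr dθ dz`). -/
abbrev Heis : Type := ℝ × ℝ × ℝ

namespace Heis

/-- The first coordinate. -/
def x (p : Heis) : ℝ := p.1

/-- The second coordinate. -/
def y (p : Heis) : ℝ := p.2.1

/-- The third (central) coordinate. -/
def z (p : Heis) : ℝ := p.2.2

/-- The cylindric radius `r = √(x² + y²)`. -/
noncomputable def radius (p : Heis) : ℝ := Real.sqrt (x p ^ 2 + y p ^ 2)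

/-- The left invariant vector field `X = ∂ₓ - (y/2) ∂_z`. -/
noncomputable def fieldX (f : Heis → ℝ) (p : Heis) : ℝ :=
  fderiv ℝ f p ((1, 0, -(y p) / 2) : Heis)

/-- The left invariant vector field `Y = ∂_y + (x/2) ∂_z`. -/
noncomputable def fieldY (f : Heis → ℝ) (p : Heis) : ℝ :=
  fderiv ℝ f p ((0, 1, x p / 2) : Heis)

/-- The sub-Laplacian `L = X² + Y²`. -/
noncomputable def subLaplacian (f : Heis → ℝ) (p : Heis) : ℝ :=
  fieldX (fieldX f) p + fieldY (fieldY f) p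

/-- The complex gradient `(X + iY) f`. -/
noncomputable def complexGradient (f : Heis → ℝ) (p : Heis) : ℂ :=
  (fieldX f p : ℂ) + Complex.I * (fieldY f p : ℂ)

/-- `u` is a bounded classical solution of the heat equation `∂ₜ u = L u`, `t > 0`, with
initial value `f`. Only the values `u t` with `0 ≤ t` matter. -/
structure IsHeatFlow (f : Heis → ℝ) (u : ℝ → Heis → ℝ) : Prop where
  initial : u 0 = f
  continuousOn : ContinuousOn (fun q : ℝ × Heis => u q.1 q.2) (Set.Ici 0 ×ˢ Set.univ)
  bounded : ∃ C : ℝ, ∀ t : ℝ, 0 ≤ t → ∀ p : Heis, |u t p| ≤ C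
  contDiff : ∀ t : ℝ, 0 < t → ContDiff ℝ 2 (u t)
  equation : ∀ t : ℝ, 0 < t → ∀ p : Heis,
    HasDerivAt (fun s : ℝ => u s p) (subLaplacian (u t) p) t

open Classical in
/-- The heat semigroup `P_t = e^{tL}`: `P_t f` is the value at time `t` of the bounded solution
of the heat equation with initial value `f` (and `0` if there is no such solution). -/
noncomputable def heatSemigroup (t : ℝ) (f : Heis → ℝ) : Heis → ℝ :=
  if h : ∃ u : ℝ → Heis → ℝ, IsHeatFlow f u then h.choose t else 0

/-- The heat kernel at the origin, in cylindric coordinates: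
`p_t(r, z) = (8π²)⁻¹ ∫ e^{iλz} (λ / sinh λt) exp(-(r²/4) λ coth λt) dλ`. -/
noncomputable def heatKernel (t r z : ℝ) : ℂ :=
  1 / (8 * (Real.pi : ℂ) ^ 2) *
    ∫ l : ℝ, Complex.exp (Complex.I * l * z) *
      ((l / Real.sinh (l * t) *
        Real.exp (-(r ^ 2 / 4) * (l * (Real.cosh (l * t) / Real.sinh (l * t)))) : ℝ) : ℂ)

/-- The pole term `1 / (4π² (t + iw + r²/4)²)`, whose only pole is `w = i (t + r²/4)`. -/
noncomputable def poleTerm (t r : ℝ) (w : ℂ) : ℂ :=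
  1 / (4 * (Real.pi : ℂ) ^ 2 * ((t : ℂ) + Complex.I * w + (r : ℂ) ^ 2 / 4) ^ 2)

/-- The strip `|Im w| < r²/4 + 3t`. -/
def strip (t r : ℝ) : Set ℂ := {w : ℂ | |w.im| < r ^ 2 / 4 + 3 * t}

/-- The strip without the point `-i (t + r²/4)`. -/
def starDomain (t r : ℝ) : Set ℂ :=
  strip t r \ {-(Complex.I * ((t + r ^ 2 / 4 : ℝ) : ℂ))}

/-- `G` is the meromorphic continuation to the strip of the function
`z ↦ p_t(r, z) - 1 / (4π² (t + iz + r²/4)²)` of a real variable, with no singularity other than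
`-i (t + r²/4)`: the singularity at `i (t + r²/4)` is removed. -/
structure IsStarKernel (t r : ℝ) (G : ℂ → ℂ) : Prop where
  meromorphicOn : MeromorphicOn G (strip t r)
  analyticOnNhd : AnalyticOnNhd ℂ G (starDomain t r)
  eq_real : ∀ z : ℝ, G (z : ℂ) = heatKernel t r z - poleTerm t r (z : ℂ)

open Classical in
/-- The kernel `p*_t(r, w)`: the meromorphic continuation of `p_t(r, ·)` minus the pole term. -/
noncomputable def starKernel (t r : ℝ) : ℂ → ℂ :=
  if h : ∃ G : ℂ → ℂ, IsStarKernel t r G then h.choose else 0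

end Heis

open MeasureTheory Filter Topology

namespace Heis

/-- The amplitude `λ / sinh λt` of the Mehler symbol. -/
noncomputable def amp (t l : ℝ) : ℝ := l / Real.sinh (l * t)

/-- The rate `λ coth λt` of the Mehler symbol. -/
noncomputable def rate (t l : ℝ) : ℝ := l * (Real.cosh (l * t) / Real.sinh (l * t))

/-- The Mehler symbol `(λ / sinh λt) exp(-(r²/4) λ coth λt)`. -/
noncomputable def symb (t r l : ℝ) : ℝ := amp t l * Real.exp (-(r ^ 2 / 4) * rate t l)

lemma heatKernel_eq (t r z : ℝ) : heatKernel t r z = 1 / (8 * (Real.pi : ℂ) ^ 2) *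
    ∫ l : ℝ, Complex.exp (Complex.I * l * z) * (symb t r l : ℂ) := rfl

lemma amp_neg (t l : ℝ) : amp t (-l) = amp t l := by
  simp [amp, Real.sinh_neg, neg_div_neg_eq]

lemma rate_neg (t l : ℝ) : rate t (-l) = rate t l := by
  simp [rate, Real.sinh_neg, Real.cosh_neg, div_neg]

lemma symb_neg (t r l : ℝ) : symb t r (-l) = symb t r l := by
  simp [symb, amp_neg, rate_neg]

lemma amp_abs (t l : ℝ) : amp t |l| = amp t l := by
  rcases abs_choice l with h | h <;> simp [h, amp_neg]

lemma rate_abs (t l : ℝ) : rate t |l| = rate t l := by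
  rcases abs_choice l with h | h <;> simp [h, rate_neg]

lemma symb_abs (t r l : ℝ) : symb t r |l| = symb t r l := by
  simp [symb, amp_abs, rate_abs]

lemma sinh_mul_pos {t l : ℝ} (ht : 0 < t) (hl : 0 < l) : 0 < Real.sinh (l * t) :=
  Real.sinh_pos_iff.2 (mul_pos hl ht)

lemma sinh_mul_ne_zero {t l : ℝ} (ht : t ≠ 0) (hl : l ≠ 0) : Real.sinh (l * t) ≠ 0 := by
  simp [Real.sinh_eq_zero, hl, ht]

lemma amp_nonneg {t : ℝ} (ht : 0 < t) (l : ℝ) : 0 ≤ amp t l := by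
  rw [← amp_abs]
  rcases (abs_nonneg l).eq_or_lt with h | h
  · simp [← h, amp]
  · exact div_nonneg h.le (sinh_mul_pos ht h).le

lemma rate_nonneg {t : ℝ} (ht : 0 < t) (l : ℝ) : 0 ≤ rate t l := by
  rw [← rate_abs]
  rcases (abs_nonneg l).eq_or_lt with h | h
  · simp [← h, rate]
  · exact mul_nonneg h.le (div_nonneg (Real.cosh_pos _).le (sinh_mul_pos ht h).le)

lemma symb_nonneg {t : ℝ} (ht : 0 < t) (r l : ℝ) : 0 ≤ symb t r l :=
  mul_nonneg (amp_nonneg ht l) (Real.exp_pos _).le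

lemma symb_le_amp {t : ℝ} (ht : 0 < t) (r l : ℝ) : symb t r l ≤ amp t l := by
  refine mul_le_of_le_one_right (amp_nonneg ht l) (Real.exp_le_one_iff.2 ?_)
  have := rate_nonneg ht l
  nlinarith [sq_nonneg r, mul_nonneg (sq_nonneg r) this]

lemma amp_le {t : ℝ} (ht : 0 < t) (l : ℝ) :
    amp t l ≤ (2 * |l| + 1 / t) * Real.exp (-(|l| * t)) := by
  rw [← amp_abs]
  rcases (abs_nonneg l).eq_or_lt with h | h
  · simp only [← h, amp, zero_div]; positivity
  set m := |l| with hm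
  have hx : 0 < m * t := mul_pos h ht
  rw [amp, div_le_iff₀ (sinh_mul_pos ht h), Real.sinh_eq]
  have e1 : Real.exp (-(m * t)) * Real.exp (m * t) = 1 := by rw [← Real.exp_add]; simp
  have e2 : Real.exp (-(m * t)) * Real.exp (-(m * t)) = Real.exp (-(2 * (m * t))) := by
    rw [← Real.exp_add]; ring_nf
  have e3 : Real.exp (-(2 * (m * t))) * (1 + 2 * (m * t)) ≤ 1 := by
    have := Real.add_one_le_exp (2 * (m * t))
    have h4 : Real.exp (-(2 * (m * t))) * Real.exp (2 * (m * t)) = 1 := by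
      rw [← Real.exp_add]; simp
    nlinarith [Real.exp_pos (-(2 * (m * t)))]
  have : (2 * m + 1 / t) * Real.exp (-(m * t)) *
      ((Real.exp (m * t) - Real.exp (-(m * t))) / 2) =
      (2 * m + 1 / t) * (1 - Real.exp (-(2 * (m * t)))) / 2 := by
    rw [← e2]; linear_combination (2 * m + 1 / t) / 2 * e1
  rw [this]
  have h5 : (2 * m + 1 / t) * (1 - Real.exp (-(2 * (m * t)))) / 2 - m =
      (1 - Real.exp (-(2 * (m * t))) * (1 + 2 * (m * t))) / (2 * t) := by
    field_simp; ring
  have : 0 ≤ (1 - Real.exp (-(2 * (m * t))) * (1 + 2 * (m * t))) / (2 * t) :=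
    div_nonneg (by linarith) (by positivity)
  linarith

lemma rate_le {t : ℝ} (ht : 0 < t) (l : ℝ) : rate t l ≤ |l| + 1 / t := by
  rw [← rate_abs]
  rcases (abs_nonneg l).eq_or_lt with h | h
  · simp only [← h, rate, zero_mul]; positivity
  set m := |l| with hm
  have hs := sinh_mul_pos ht h
  have hx : 0 < m * t := mul_pos h ht
  rw [rate, ← mul_div_assoc, div_le_iff₀ hs]
  have h1 : m * t ≤ Real.sinh (m * t) := Real.self_le_sinh_iff.2 hx.le
  have h2 : Real.cosh (m * t) - Real.sinh (m * t) ≤ 1 := by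
    rw [Real.cosh_sub_sinh]; exact Real.exp_le_one_iff.2 (by linarith)
  have h3 : (|l| + 1 / t) * Real.sinh (m * t) = m * Real.sinh (m * t) +
    Real.sinh (m * t) / t := by rw [← hm]; ring
  have h4 : m ≤ Real.sinh (m * t) / t := by rwa [le_div_iff₀ ht]
  rw [← hm] at h3
  rw [h3]; nlinarith

lemma abs_le_rate {t l : ℝ} (ht : 0 < t) : |l| ≤ rate t l := by
  rw [← rate_abs]
  rcases (abs_nonneg l).eq_or_lt with h | h
  · simp [← h, rate]
  refine le_mul_of_one_le_right h.le ?_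
  rw [le_div_iff₀ (sinh_mul_pos ht h), one_mul]
  exact (Real.sinh_lt_cosh _).le

lemma rate_sq_sub_amp_sq {t l : ℝ} (ht : t ≠ 0) (hl : l ≠ 0) :
    rate t l ^ 2 - amp t l ^ 2 = l ^ 2 := by
  have hs := sinh_mul_ne_zero ht hl
  have := Real.cosh_sq (l * t)
  simp only [rate, amp]; field_simp; rw [this]; ring

lemma rate_shift {t l : ℝ} (ht : t ≠ 0) (hl : l ≠ 0) :
    (l + rate t l) * Real.exp (-2 * l * t) = rate t l - l := by
  have hs := sinh_mul_ne_zero ht hl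
  have e1 : Real.exp (-2 * l * t) * Real.exp (l * t) = Real.exp (-(l * t)) := by
    rw [← Real.exp_add]; ring_nf
  have e2 := Real.cosh_add_sinh (l * t)
  have e3 := Real.cosh_sub_sinh (l * t)
  rw [← e2, ← e3] at e1
  generalize Real.exp (-2 * l * t) = E at e1 ⊢
  simp only [rate]; field_simp
  linear_combination e1

lemma hasDerivAt_amp {t l : ℝ} (ht : t ≠ 0) (hl : l ≠ 0) :
    HasDerivAt (fun s => amp s l) (-(amp t l * rate t l)) t := by
  have hs := sinh_mul_ne_zero ht hl
  have h1 : HasDerivAt (fun s => Real.sinh (l * s)) (Real.cosh (l * t) * (l * 1)) t :=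
    ((hasDerivAt_id t).const_mul l).sinh
  convert! (hasDerivAt_const t l).div h1 hs using 1
  simp only [amp, rate]; field_simp; ring

lemma hasDerivAt_rate {t l : ℝ} (ht : t ≠ 0) (hl : l ≠ 0) :
    HasDerivAt (fun s => rate s l) (-(amp t l) ^ 2) t := by
  have hs := sinh_mul_ne_zero ht hl
  have h1 : HasDerivAt (fun s => Real.sinh (l * s)) (Real.cosh (l * t) * (l * 1)) t :=
    ((hasDerivAt_id t).const_mul l).sinh
  have h2 : HasDerivAt (fun s => Real.cosh (l * s)) (Real.sinh (l * t) * (l * 1)) t :=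
    ((hasDerivAt_id t).const_mul l).cosh
  convert! (h2.div h1 hs).const_mul l using 1
  have := Real.cosh_sq (l * t)
  simp only [amp]; field_simp; rw [this]; ring

lemma hasDerivAt_symb {t l : ℝ} (ht : t ≠ 0) (hl : l ≠ 0) (r : ℝ) :
    HasDerivAt (fun s => symb s r l)
      ((r ^ 2 / 4 * (rate t l ^ 2 - l ^ 2) - rate t l) * symb t r l) t := by
  convert! (hasDerivAt_amp ht hl).mul
    (((hasDerivAt_rate ht hl).const_mul (-(r ^ 2 / 4))).exp) using 1
  rw [← rate_sq_sub_amp_sq ht hl, symb]; ring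

lemma integrable_of_integrableOn_Ioi_abs {f : ℝ → ℝ} (h : IntegrableOn f (Set.Ioi 0)) :
    Integrable fun l : ℝ => f |l| := by
  have h1 : IntegrableOn (fun l : ℝ => f |l|) (Set.Ioi 0) :=
    h.congr_fun (fun l hl => by simp only [abs_of_pos (Set.mem_Ioi.1 hl)]) measurableSet_Ioi
  have h2 : IntegrableOn (fun l : ℝ => f |l|) (Set.Iio 0) := by
    have := IntegrableOn.comp_neg_Iio (c := (0 : ℝ)) (f := fun l : ℝ => f |l|) (by simpa using h1)
    simpa using this
  rw [← integrableOn_univ, ← Set.Iic_union_Ioi (a := (0 : ℝ))]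
  exact ((integrableOn_Iic_iff_integrableOn_Iio).2 h2).union h1

lemma integrable_abs_pow_mul_exp (n : ℕ) {b : ℝ} (hb : 0 < b) :
    Integrable fun l : ℝ => |l| ^ n * Real.exp (-(|l| * b)) := by
  have h : IntegrableOn (fun l : ℝ => l ^ n * Real.exp (-(l * b))) (Set.Ioi 0) := by
    have := integrableOn_rpow_mul_exp_neg_mul_rpow (p := 1) (s := n) (b := b)
      (by have := Nat.cast_nonneg (α := ℝ) n; linarith) one_pos hb
    simpa [mul_comm b] using this
  exact integrable_of_integrableOn_Ioi_abs (f := fun l : ℝ => l ^ n * Real.exp (-(l * b))) h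

lemma integrable_add_pow_mul_exp (n : ℕ) (c : ℝ) {b : ℝ} (hb : 0 < b) :
    Integrable fun l : ℝ => (|l| + c) ^ n * Real.exp (-(|l| * b)) := by
  simp_rw [add_pow, Finset.sum_mul]
  refine integrable_finsetSum _ fun i _ => ?_
  convert! (integrable_abs_pow_mul_exp i hb).const_mul (c ^ (n - i) * (n.choose i)) using 2
  ring

lemma measurable_amp (t : ℝ) : Measurable (amp t) := by unfold amp; fun_prop

lemma measurable_rate (t : ℝ) : Measurable (rate t) := by unfold rate; fun_prop

lemma integrable_amp {t : ℝ} (ht : 0 < t) : Integrable (amp t) := by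
  refine ((integrable_add_pow_mul_exp 1 (1 / (2 * t)) ht).const_mul 2).mono'
    (measurable_amp t).aestronglyMeasurable (ae_of_all _ fun l => ?_)
  rw [Real.norm_of_nonneg (amp_nonneg ht l)]
  refine (amp_le ht l).trans_eq ?_
  field_simp

lemma norm_exp_I_mul (l z : ℝ) : ‖Complex.exp (Complex.I * l * z)‖ = 1 := by
  rw [Complex.norm_exp]; simp

lemma norm_exp_mul_symb {t : ℝ} (ht : 0 < t) (r z l : ℝ) :
    ‖Complex.exp (Complex.I * l * z) * (symb t r l : ℂ)‖ = symb t r l := by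
  rw [norm_mul, norm_exp_I_mul, one_mul, Complex.norm_real, Real.norm_of_nonneg (symb_nonneg ht r l)]

lemma measurable_symb (t r : ℝ) : Measurable (symb t r) := by
  have := measurable_amp t
  have := measurable_rate t
  unfold symb; fun_prop

lemma integrable_exp_mul_symb {t : ℝ} (ht : 0 < t) (r z : ℝ) :
    Integrable fun l : ℝ => Complex.exp (Complex.I * l * z) * (symb t r l : ℂ) := by
  have := measurable_symb t r
  refine (integrable_amp ht).mono' (by fun_prop) (ae_of_all _ fun l => ?_)
  rw [norm_exp_mul_symb ht]
  exact symb_le_amp ht r l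

lemma heatKernel_neg (t r z : ℝ) : heatKernel t r (-z) = heatKernel t r z := by
  rw [heatKernel_eq, heatKernel_eq, ← integral_neg_eq_self]
  congr 2; ext l
  rw [symb_neg]; push_cast; ring_nf

lemma heatKernel_re (t r z : ℝ) : ((heatKernel t r z).re : ℂ) = heatKernel t r z := by
  rw [← Complex.conj_eq_iff_re]
  conv_rhs => rw [← heatKernel_neg]
  rw [heatKernel_eq, heatKernel_eq, map_mul, ← integral_conj]
  congr 1
  · simp [Complex.conj_ofNat]
  · congr 1; ext l
    rw [map_mul, ← Complex.exp_conj]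
    simp

lemma symb_scale {t : ℝ} (ht : 0 < t) (r l : ℝ) :
    symb t r l = t⁻¹ * symb 1 (r / Real.sqrt t) (l * t) := by
  simp only [symb, amp, rate, div_pow, Real.sq_sqrt ht.le, mul_one]
  rw [show -(r ^ 2 / t / 4) * (l * t * (Real.cosh (l * t) / Real.sinh (l * t))) =
    -(r ^ 2 / 4) * (l * (Real.cosh (l * t) / Real.sinh (l * t))) by field_simp]
  field_simp

lemma heatKernel_scale {t : ℝ} (ht : 0 < t) (r z : ℝ) :
    heatKernel t r z = ((t ^ 2)⁻¹ : ℝ) * heatKernel 1 (r / Real.sqrt t) (z / t) := by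
  have key := Measure.integral_comp_mul_right (fun l : ℝ =>
    Complex.exp (Complex.I * l * (z / t : ℝ)) * (symb 1 (r / Real.sqrt t) l : ℂ)) t
  rw [heatKernel_eq, heatKernel_eq, mul_left_comm]
  congr 1
  have e : (fun l : ℝ => Complex.exp (Complex.I * l * z) * (symb t r l : ℂ)) = fun l : ℝ =>
      (t⁻¹ : ℂ) * (Complex.exp (Complex.I * (l * t : ℝ) * (z / t : ℝ)) *
        (symb 1 (r / Real.sqrt t) (l * t) : ℂ)) := by
    ext l
    rw [symb_scale ht]
    have : Complex.I * (l * t : ℝ) * (z / t : ℝ) = Complex.I * l * z := by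
      push_cast; field_simp [ht.ne']
    rw [this]; push_cast; ring
  rw [e, integral_const_mul, key, abs_of_pos (inv_pos.2 ht)]
  simp only [Complex.real_smul]
  push_cast; ring

/-- The heat kernel at the origin as a function on the group. -/
noncomputable def kern (t : ℝ) (q : Heis) : ℝ := (heatKernel t (radius q) (z q)).re

lemma ofReal_kern (t : ℝ) (q : Heis) : (kern t q : ℂ) = heatKernel t (radius q) (z q) :=
  heatKernel_re _ _ _

lemma continuous_x : Continuous x := continuous_fst
lemma continuous_y : Continuous y := continuous_snd.fst
lemma continuous_z : Continuous z := continuous_snd.snd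

lemma continuous_radius : Continuous radius := by
  have := continuous_x
  have := continuous_y
  unfold radius; fun_prop

lemma radius_sq (p : Heis) : radius p ^ 2 = x p ^ 2 + y p ^ 2 := Real.sq_sqrt (by positivity)

lemma continuous_kern {t : ℝ} (ht : 0 < t) : Continuous (kern t) := by
  have h := continuous_radius
  have h' := continuous_z
  unfold kern
  simp_rw [heatKernel_eq]
  refine Complex.continuous_re.comp (continuous_const.mul ?_)
  refine continuous_of_dominated (bound := amp t) (fun q => ?_) (fun q => ae_of_all _ fun l => ?_)
    (integrable_amp ht) (ae_of_all _ fun l => ?_)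
  · exact (integrable_exp_mul_symb ht _ _).1
  · rw [norm_exp_mul_symb ht]; exact symb_le_amp ht _ _
  · unfold symb; fun_prop

/-- The entire function `sinh w / w`. -/
noncomputable def sinhc : ℂ → ℂ := dslope Complex.sinh 0

lemma sinhc_of_ne {w : ℂ} (hw : w ≠ 0) : sinhc w = Complex.sinh w / w := by
  rw [sinhc, dslope_of_ne _ hw, slope_def_field]; simp

lemma sinhc_zero : sinhc 0 = 1 := by
  rw [sinhc, dslope_same, Complex.deriv_sinh]; simp

lemma differentiable_sinhc : Differentiable ℂ sinhc := by
  rw [← differentiableOn_univ, sinhc, Complex.differentiableOn_dslope univ_mem]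
  exact Complex.differentiable_sinh.differentiableOn

lemma sinh_add_mul_I (a b : ℝ) : Complex.sinh (a + b * Complex.I) =
    ⟨Real.sinh a * Real.cos b, Real.cosh a * Real.sin b⟩ := by
  rw [Complex.sinh_add, Complex.sinh_mul_I, Complex.cosh_mul_I]
  apply Complex.ext <;> simp [← Complex.ofReal_sinh, ← Complex.ofReal_cosh, ← Complex.ofReal_sin,
    ← Complex.ofReal_cos]

lemma cosh_add_mul_I (a b : ℝ) : Complex.cosh (a + b * Complex.I) =
    ⟨Real.cosh a * Real.cos b, Real.sinh a * Real.sin b⟩ := by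
  rw [Complex.cosh_add, Complex.sinh_mul_I, Complex.cosh_mul_I]
  apply Complex.ext <;> simp [← Complex.ofReal_sinh, ← Complex.ofReal_cosh, ← Complex.ofReal_sin,
    ← Complex.ofReal_cos]

lemma normSq_sinh (a b : ℝ) : Complex.normSq (Complex.sinh (a + b * Complex.I)) =
    Real.sinh a ^ 2 + Real.sin b ^ 2 := by
  rw [sinh_add_mul_I, Complex.normSq_mk]
  have h1 := Real.cosh_sq a
  have h2 := Real.sin_sq_add_cos_sq b
  linear_combination Real.sin b ^ 2 * h1 + Real.sinh a ^ 2 * h2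

lemma sinh_le_mul_cosh {a : ℝ} (ha : 0 ≤ a) : Real.sinh a ≤ a * Real.cosh a := by
  have h : MonotoneOn (fun s : ℝ => s * Real.cosh s - Real.sinh s) (Set.Ici 0) := by
    refine monotoneOn_of_hasDerivWithinAt_nonneg (f' := fun s => s * Real.sinh s) (convex_Ici 0)
      (by fun_prop) (fun s hs => ?_) (fun s hs => ?_)
    · have := ((hasDerivAt_id s).mul (Real.hasDerivAt_cosh s)).sub (Real.hasDerivAt_sinh s)
      refine HasDerivAt.hasDerivWithinAt ?_
      convert! this using 1
      simp
    · rw [interior_Ici] at hs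
      exact mul_nonneg hs.le (Real.sinh_nonneg_iff.2 hs.le)
  have := h Set.self_mem_Ici ha ha
  simp at this
  linarith

lemma sinh_sq_le (a : ℝ) : Real.sinh a ^ 2 ≤ a * Real.cosh a * Real.sinh a := by
  rcases le_total 0 a with h | h
  · nlinarith [sinh_le_mul_cosh h, Real.sinh_nonneg_iff.2 h]
  · have h1 := sinh_le_mul_cosh (neg_nonneg.2 h)
    have h2 := Real.sinh_nonneg_iff.2 (neg_nonneg.2 h)
    rw [Real.sinh_neg] at h1 h2
    rw [Real.cosh_neg] at h1
    nlinarith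

lemma cos_one_mul_normSq_sinh_le {a b : ℝ} (hb0 : 0 ≤ b) (hb1 : b ≤ 1) :
    Real.cos 1 * (Real.sinh a ^ 2 + Real.sin b ^ 2) ≤
      a * Real.cosh a * Real.sinh a + b * Real.sin b * Real.cos b := by
  have hpi := Real.pi_gt_three
  have h1 : Real.cos 1 ≤ Real.cos b :=
    Real.cos_le_cos_of_nonneg_of_le_pi hb0 (by linarith) hb1
  have h2 : 0 < Real.cos 1 := Real.cos_one_pos
  have h3 : 0 ≤ Real.sin b := Real.sin_nonneg_of_nonneg_of_le_pi hb0 (by linarith)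
  have h4 : Real.sin b ≤ b := Real.sin_le hb0
  have h5 := sinh_sq_le a
  have h6 : Real.cos 1 * Real.sinh a ^ 2 ≤ Real.sinh a ^ 2 :=
    mul_le_of_le_one_left (sq_nonneg _) (Real.cos_le_one 1)
  have h7 : Real.cos 1 * Real.sin b ^ 2 ≤ b * Real.sin b * Real.cos b := by
    calc Real.cos 1 * Real.sin b ^ 2 = Real.sin b * Real.sin b * Real.cos 1 := by ring
      _ ≤ b * Real.sin b * Real.cos b := by gcongr
  linarith

lemma re_mul_coth (a b : ℝ) :
    ((a + b * Complex.I) * (Complex.cosh (a + b * Complex.I) / Complex.sinh (a + b * Complex.I))).re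
    = (a * Real.cosh a * Real.sinh a + b * Real.sin b * Real.cos b) /
      (Real.sinh a ^ 2 + Real.sin b ^ 2) := by
  rw [← normSq_sinh, div_eq_mul_inv (Complex.cosh _), Complex.inv_def, ← mul_assoc, ← mul_assoc,
    Complex.re_mul_ofReal, ← div_eq_mul_inv]
  congr 1
  rw [sinh_add_mul_I, cosh_add_mul_I]
  simp only [Complex.mul_re, Complex.mul_im, Complex.add_re, Complex.add_im, Complex.ofReal_re,
    Complex.ofReal_im, Complex.I_re, Complex.I_im, Complex.conj_re, Complex.conj_im]
  have h1 := Real.cosh_sq a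
  have h2 := Real.sin_sq_add_cos_sq b
  linear_combination (a * Real.cosh a * Real.sinh a) * h2 + b * Real.sin b * Real.cos b * h1

/-- The holomorphic extension of the Mehler symbol at time `1`, with `ρ = r²/4`. -/
noncomputable def holoSymb (ρ : ℝ) (w : ℂ) : ℂ :=
  Complex.exp (-ρ * (Complex.cosh w / sinhc w)) / sinhc w

lemma holoSymb_ofReal (r : ℝ) {l : ℝ} (hl : l ≠ 0) : holoSymb (r ^ 2 / 4) l = symb 1 r l := by
  have hl' : (l : ℂ) ≠ 0 := by exact_mod_cast hl
  rw [holoSymb, sinhc_of_ne hl', symb, amp, rate]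
  push_cast
  simp only [mul_one, div_div_eq_mul_div]
  rw [mul_comm _ (l : ℂ), mul_comm (Complex.cosh _) (l : ℂ), mul_div_assoc, mul_div_assoc]
  ring

lemma sinh_ne_zero_of_strip {a b : ℝ} (hb0 : 0 ≤ b) (hb1 : b ≤ 1)
    (h : (a + b * Complex.I : ℂ) ≠ 0) : 0 < Real.sinh a ^ 2 + Real.sin b ^ 2 := by
  by_cases ha : a = 0
  · have hb : 0 < b := hb0.lt_of_ne (by rintro rfl; simp [ha] at h)
    have := Real.sin_pos_of_pos_of_lt_pi hb (by linarith [Real.pi_gt_three])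
    positivity
  · have : Real.sinh a ≠ 0 := by simpa using ha
    positivity

lemma norm_holoSymb_le {ρ a b : ℝ} (hρ : 0 ≤ ρ) (hb0 : 0 ≤ b) (hb1 : b ≤ 1)
    (h : (a + b * Complex.I : ℂ) ≠ 0) :
    ‖holoSymb ρ (a + b * Complex.I)‖ ≤ Real.exp (-(ρ * Real.cos 1)) *
      ((|a| + 1) / Real.sqrt (Real.sinh a ^ 2 + Real.sin b ^ 2)) := by
  have hpos := sinh_ne_zero_of_strip hb0 hb1 h
  rw [holoSymb, norm_div, div_eq_mul_inv, ← norm_inv, sinhc_of_ne h, inv_div, norm_div]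
  gcongr
  · rw [Complex.norm_exp, Real.exp_le_exp, div_div_eq_mul_div, mul_comm (Complex.cosh _),
      mul_div_assoc, ← Complex.ofReal_neg, Complex.re_ofReal_mul, re_mul_coth]
    have := (le_div_iff₀ hpos).2 (cos_one_mul_normSq_sinh_le (a := a) hb0 hb1)
    nlinarith
  · refine (norm_add_le _ _).trans ?_
    simp only [Complex.norm_mul, Complex.norm_real, Real.norm_eq_abs, Complex.norm_I, mul_one,
      abs_of_nonneg hb0]
    linarith
  · rw [← normSq_sinh, Complex.normSq_eq_norm_sq, Real.sqrt_sq (norm_nonneg _)]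

lemma sinhc_ne_zero {w : ℂ} (h0 : 0 ≤ w.im) (h1 : w.im ≤ 1) : sinhc w ≠ 0 := by
  by_cases h : w = 0
  · simp [h, sinhc_zero]
  · rw [sinhc_of_ne h]
    refine div_ne_zero (fun hs => ?_) h
    rw [← Complex.re_add_im w] at hs h
    have := sinh_ne_zero_of_strip h0 h1 h
    rw [← normSq_sinh, hs] at this
    simp at this

lemma differentiableAt_holoSymb (ρ : ℝ) {w : ℂ} (h0 : 0 ≤ w.im) (h1 : w.im ≤ 1) :
    DifferentiableAt ℂ (holoSymb ρ) w := by
  have h := sinhc_ne_zero h0 h1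
  have hd : DifferentiableAt ℂ sinhc w := differentiable_sinhc w
  unfold holoSymb
  have := Complex.differentiable_cosh w
  exact DifferentiableAt.div (((this.div hd h).const_mul _).cexp) hd h

lemma norm_holoSymb_add_I_le {ρ : ℝ} (hρ : 0 ≤ ρ) (a : ℝ) :
    ‖holoSymb ρ (a + Complex.I)‖ ≤ Real.exp (-(ρ * Real.cos 1)) *
      (2 / Real.sin 1 * ((|a| + 1) * Real.exp (-|a|))) := by
  have hs1 : 0 < Real.sin 1 := Real.sin_pos_of_pos_of_lt_pi one_pos (by linarith [Real.pi_gt_three])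
  have hne : (a + (1 : ℝ) * Complex.I : ℂ) ≠ 0 := by
    intro h; simpa using congrArg Complex.im h
  have := norm_holoSymb_le hρ zero_le_one le_rfl hne
  rw [Complex.ofReal_one, one_mul] at this
  refine this.trans (mul_le_mul_of_nonneg_left ?_ (Real.exp_pos _).le)
  have h1 : Real.sin 1 * (Real.exp |a| / 2) ≤ Real.sqrt (Real.sinh a ^ 2 + Real.sin 1 ^ 2) := by
    apply Real.le_sqrt_of_sq_le
    have h2 : Real.exp |a| / 2 ≤ Real.cosh a := by
      rw [← Real.cosh_abs, Real.cosh_eq]; linarith [Real.exp_pos (-|a|)]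
    have h3 : Real.sin 1 ^ 2 * Real.cosh a ^ 2 ≤ Real.sinh a ^ 2 + Real.sin 1 ^ 2 := by
      rw [Real.cosh_sq]; nlinarith [Real.sin_sq_le_one 1, sq_nonneg (Real.sinh a)]
    refine le_trans ?_ h3
    rw [mul_pow]; gcongr
  calc (|a| + 1) / Real.sqrt (Real.sinh a ^ 2 + Real.sin 1 ^ 2)
      ≤ (|a| + 1) / (Real.sin 1 * (Real.exp |a| / 2)) := by gcongr
    _ = _ := by rw [Real.exp_neg]; field_simp

lemma norm_holoSymb_le_of_one_le {ρ a b : ℝ} (hρ : 0 ≤ ρ) (hb0 : 0 ≤ b) (hb1 : b ≤ 1)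
    (ha : 1 ≤ |a|) :
    ‖holoSymb ρ (a + b * Complex.I)‖ ≤ 2 * ((2 * |a| + 1) * Real.exp (-|a|)) := by
  have hne : (a + b * Complex.I : ℂ) ≠ 0 := by
    intro h
    have : a = 0 := by simpa using congrArg Complex.re h
    simp [this] at ha
    linarith
  have hc := Real.cos_one_pos
  refine (norm_holoSymb_le hρ hb0 hb1 hne).trans ?_
  have hsh : 0 < Real.sinh |a| := Real.sinh_pos_iff.2 (by linarith)
  have h1 : Real.sinh |a| ≤ Real.sqrt (Real.sinh a ^ 2 + Real.sin b ^ 2) := by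
    apply Real.le_sqrt_of_sq_le
    rw [← Real.abs_sinh, sq_abs]; nlinarith [sq_nonneg (Real.sin b)]
  calc Real.exp (-(ρ * Real.cos 1)) * ((|a| + 1) / Real.sqrt (Real.sinh a ^ 2 + Real.sin b ^ 2))
      ≤ 1 * ((|a| + |a|) / Real.sinh |a|) := by
        gcongr
        exact Real.exp_le_one_iff.2 (by nlinarith [mul_nonneg hρ hc.le])
    _ = 2 * amp 1 |a| := by rw [amp, mul_one]; ring
    _ ≤ _ := by
        gcongr
        simpa using amp_le one_pos |a|

lemma ae_ne_zero : ∀ᵐ l : ℝ, l ≠ 0 := by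
  simp [ae_iff, measure_singleton]

lemma norm_exp_strip_le {a b z : ℝ} (hz : 0 ≤ z) (hb : 0 ≤ b) :
    ‖Complex.exp (Complex.I * (a + b * Complex.I) * z)‖ ≤ 1 := by
  rw [Complex.norm_exp, Real.exp_le_one_iff]
  simp
  nlinarith [mul_nonneg hb hz]

lemma integrable_abs_add_mul_exp : Integrable fun a : ℝ => (|a| + 1) * Real.exp (-|a|) := by
  simpa using integrable_add_pow_mul_exp 1 1 one_pos

lemma tendsto_two_mul_add_mul_exp :
    Tendsto (fun a : ℝ => 4 * ((2 * a + 1) * Real.exp (-a))) atTop (𝓝 0) := by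
  have h1 := Real.tendsto_pow_mul_exp_neg_atTop_nhds_zero 1
  have h0 := Real.tendsto_pow_mul_exp_neg_atTop_nhds_zero 0
  have := ((h1.const_mul 2).add h0).const_mul 4
  simp only [mul_zero, add_zero] at this
  refine this.congr fun a => ?_
  simp; ring

lemma integral_holoSymb_shift {ρ z : ℝ} (hρ : 0 ≤ ρ) (hz : 0 ≤ z)
    (hi : Integrable fun l : ℝ => Complex.exp (Complex.I * l * z) * holoSymb ρ l)
    (hi' : Integrable fun l : ℝ =>
      Complex.exp (Complex.I * (l + Complex.I) * z) * holoSymb ρ (l + Complex.I)) :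
    ∫ l : ℝ, Complex.exp (Complex.I * l * z) * holoSymb ρ l =
      ∫ l : ℝ, Complex.exp (Complex.I * (l + Complex.I) * z) * holoSymb ρ (l + Complex.I) := by
  set g : ℂ → ℂ := fun w => Complex.exp (Complex.I * w * z) * holoSymb ρ w with hg
  have hrect : ∀ N : ℝ, ((∫ l : ℝ in -N..N, g l) - ∫ l : ℝ in -N..N, g (l + Complex.I)) =
      Complex.I * (∫ b : ℝ in (0 : ℝ)..1, g ((-N : ℝ) + b * Complex.I)) -
      Complex.I * ∫ b : ℝ in (0 : ℝ)..1, g (N + b * Complex.I) := by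
    intro N
    have hd : DifferentiableOn ℂ g
        (Set.uIcc (⟨-N, 0⟩ : ℂ).re (⟨N, 1⟩ : ℂ).re ×ℂ Set.uIcc (⟨-N, 0⟩ : ℂ).im (⟨N, 1⟩ : ℂ).im) := by
      intro w hw
      rw [Complex.mem_reProdIm] at hw
      have h2 := hw.2
      simp only [Set.uIcc_of_le zero_le_one, Set.mem_Icc] at h2
      refine DifferentiableAt.differentiableWithinAt ?_
      exact DifferentiableAt.mul (by fun_prop) (differentiableAt_holoSymb ρ h2.1 h2.2)
    have := Complex.integral_boundary_rect_eq_zero_of_differentiableOn g ⟨-N, 0⟩ ⟨N, 1⟩ hd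
    simp only [Complex.ofReal_zero, zero_mul, add_zero, Complex.ofReal_one, one_mul,
      smul_eq_mul] at this
    linear_combination this
  have hl : Tendsto (fun N : ℝ => (∫ l : ℝ in -N..N, g l) - ∫ l : ℝ in -N..N, g (l + Complex.I))
      atTop (𝓝 ((∫ l : ℝ, g l) - ∫ l : ℝ, g (l + Complex.I))) :=
    (intervalIntegral_tendsto_integral hi tendsto_neg_atTop_atBot tendsto_id).sub
      (intervalIntegral_tendsto_integral hi' tendsto_neg_atTop_atBot tendsto_id)
  have hr : Tendsto (fun N : ℝ => (∫ l : ℝ in -N..N, g l) - ∫ l : ℝ in -N..N, g (l + Complex.I))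
      atTop (𝓝 0) := by
    refine squeeze_zero_norm' ?_ tendsto_two_mul_add_mul_exp
    filter_upwards [eventually_ge_atTop 1] with N hN
    rw [hrect]
    have key : ∀ a : ℝ, |a| = N → ‖∫ b : ℝ in (0 : ℝ)..1, g (a + b * Complex.I)‖ ≤
        2 * ((2 * N + 1) * Real.exp (-N)) := by
      intro a ha
      have := intervalIntegral.norm_integral_le_of_norm_le_const (a := (0 : ℝ)) (b := 1)
        (f := fun b : ℝ => g (a + b * Complex.I)) (C := 2 * ((2 * N + 1) * Real.exp (-N)))
        fun b hb => ?_
      · simpa using this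
      rw [Set.uIoc_of_le zero_le_one] at hb
      rw [hg, norm_mul]
      have h1 := norm_exp_strip_le (a := a) hz hb.1.le
      have h2 := norm_holoSymb_le_of_one_le hρ hb.1.le hb.2 (ha.symm ▸ hN)
      rw [ha] at h2
      exact (mul_le_of_le_one_left (norm_nonneg _) h1).trans h2
    have k1 := key (-N) (by rw [abs_neg, abs_of_nonneg (by linarith)])
    have k2 := key N (abs_of_nonneg (by linarith))
    refine (norm_sub_le _ _).trans ?_
    simp only [norm_mul, Complex.norm_I, one_mul]
    linarith
  exact sub_eq_zero.1 (tendsto_nhds_unique hl hr)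

lemma continuous_holoSymb_ofReal (ρ : ℝ) : Continuous fun l : ℝ => holoSymb ρ l := by
  rw [continuous_iff_continuousAt]
  intro l
  have : ContinuousAt (holoSymb ρ) (l : ℂ) :=
    (differentiableAt_holoSymb ρ (w := l) (by simp) (by simp)).continuousAt
  exact ContinuousAt.comp (f := fun l : ℝ => (l : ℂ)) this Complex.continuous_ofReal.continuousAt

lemma continuous_holoSymb_add_I (ρ : ℝ) :
    Continuous fun l : ℝ => holoSymb ρ (l + Complex.I) := by
  rw [continuous_iff_continuousAt]
  intro l
  have : ContinuousAt (holoSymb ρ) (l + Complex.I : ℂ) :=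
    (differentiableAt_holoSymb ρ (w := l + Complex.I) (by simp) (by simp)).continuousAt
  exact ContinuousAt.comp (f := fun l : ℝ => (l + Complex.I : ℂ)) this (by fun_prop)

lemma exp_mul_symb_ae_eq (r z : ℝ) :
    (fun l : ℝ => Complex.exp (Complex.I * l * z) * (symb 1 r l : ℂ)) =ᵐ[volume]
      fun l : ℝ => Complex.exp (Complex.I * l * z) * holoSymb (r ^ 2 / 4) l := by
  filter_upwards [ae_ne_zero] with l hl
  rw [holoSymb_ofReal r hl]

/-- A constant in the pointwise bound of the heat kernel. -/
noncomputable def kernBound : ℝ :=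
  1 / (8 * Real.pi ^ 2) * ∫ a : ℝ, 2 / Real.sin 1 * ((|a| + 1) * Real.exp (-|a|))

lemma norm_heatKernel_one_le (r z : ℝ) : ‖heatKernel 1 r z‖ ≤
    kernBound * (Real.exp (-|z|) * Real.exp (-(r ^ 2 / 4 * Real.cos 1))) := by
  wlog hz : 0 ≤ z generalizing z
  · have := this (-z) (by linarith)
    rwa [heatKernel_neg, abs_neg] at this
  have hρ : 0 ≤ r ^ 2 / 4 := by positivity
  have hb : ∀ l : ℝ, ‖Complex.exp (Complex.I * (l + Complex.I) * z) *
      holoSymb (r ^ 2 / 4) (l + Complex.I)‖ ≤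
      Real.exp (-|z|) * Real.exp (-(r ^ 2 / 4 * Real.cos 1)) *
      (2 / Real.sin 1 * ((|l| + 1) * Real.exp (-|l|))) := by
    intro l
    rw [norm_mul, mul_assoc (Real.exp (-|z|))]
    refine mul_le_mul ?_ ?_ (norm_nonneg _) (Real.exp_pos _).le
    · rw [Complex.norm_exp, abs_of_nonneg hz]; simp
    · exact norm_holoSymb_add_I_le hρ l
  have hint := (integrable_abs_add_mul_exp.const_mul (2 / Real.sin 1)).const_mul
    (Real.exp (-|z|) * Real.exp (-(r ^ 2 / 4 * Real.cos 1)))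
  have hc := continuous_holoSymb_add_I (r ^ 2 / 4)
  have hi' : Integrable fun l : ℝ => Complex.exp (Complex.I * (l + Complex.I) * z) *
      holoSymb (r ^ 2 / 4) (l + Complex.I) :=
    hint.mono' (by fun_prop) (ae_of_all _ hb)
  rw [heatKernel_eq, integral_congr_ae (exp_mul_symb_ae_eq r z),
    integral_holoSymb_shift hρ hz ((integrable_exp_mul_symb one_pos r z).congr
      (exp_mul_symb_ae_eq r z)) hi', norm_mul]
  have h1 := norm_integral_le_of_norm_le hint (ae_of_all _ hb)
  rw [integral_const_mul] at h1
  have h2 : ‖(1 / (8 * (Real.pi : ℂ) ^ 2))‖ = 1 / (8 * Real.pi ^ 2) := by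
    simp [abs_of_pos Real.pi_pos]
  rw [h2, kernBound]
  calc _ ≤ 1 / (8 * Real.pi ^ 2) * _ := mul_le_mul_of_nonneg_left h1 (by positivity)
    _ = _ := by ring

lemma integrable_exp_neg_abs : Integrable fun z : ℝ => Real.exp (-|z|) := by
  simpa using integrable_add_pow_mul_exp 0 1 one_pos

lemma continuous_heatKernel {t : ℝ} (ht : 0 < t) (r : ℝ) : Continuous (heatKernel t r) := by
  simp_rw [funext (heatKernel_eq t r)]
  refine continuous_const.mul ?_
  refine continuous_of_dominated (bound := amp t) (fun q => ?_) (fun q => ae_of_all _ fun l => ?_)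
    (integrable_amp ht) (ae_of_all _ fun l => ?_)
  · exact (integrable_exp_mul_symb ht _ _).1
  · rw [norm_exp_mul_symb ht]; exact symb_le_amp ht _ _
  · fun_prop

lemma integrable_heatKernel_one (r : ℝ) : Integrable (heatKernel 1 r) := by
  refine ((integrable_exp_neg_abs.mul_const (Real.exp (-(r ^ 2 / 4 * Real.cos 1)))).const_mul
    kernBound).mono' (continuous_heatKernel one_pos r).aestronglyMeasurable
    (ae_of_all _ (norm_heatKernel_one_le r))

open scoped FourierTransform in
lemma integral_heatKernel_one (r : ℝ) :
    ∫ z : ℝ, heatKernel 1 r z = (1 / (4 * Real.pi) * Real.exp (-(r ^ 2 / 4)) : ℝ) := by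
  set φ : ℝ → ℂ := fun l => holoSymb (r ^ 2 / 4) l with hφ
  have hφc : Continuous φ := continuous_holoSymb_ofReal _
  have hφi : Integrable φ := by
    have h := (integrable_exp_mul_symb one_pos r 0).congr (exp_mul_symb_ae_eq r 0)
    simpa using h
  have hF : ∀ ξ : ℝ, 𝓕⁻ φ ξ = 8 * (Real.pi : ℂ) ^ 2 * heatKernel 1 r (2 * Real.pi * ξ) := by
    intro ξ
    rw [Real.fourierInv_eq', heatKernel_eq, integral_congr_ae (exp_mul_symb_ae_eq r _),
      ← mul_assoc, mul_one_div_cancel (by simp [Real.pi_ne_zero]), one_mul]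
    congr 1; ext l
    rw [smul_eq_mul]
    congr 2
    simp
    ring
  have hFi : Integrable (𝓕⁻ φ) := by
    rw [funext hF]
    exact ((integrable_heatKernel_one r).comp_mul_left' (by positivity)).const_mul _
  have hFi' : Integrable (𝓕 φ) := by
    refine hFi.comp_neg.congr (ae_of_all _ fun ξ => ?_)
    simp [Real.fourierInv_eq_fourier_neg]
  have key := congrFun (hφc.fourier_fourierInv_eq hφi hFi') 0
  rw [Real.fourier_eq'] at key
  simp only [inner_zero_right, mul_zero, Complex.ofReal_zero, zero_mul, Complex.exp_zero,
    one_smul, hF] at key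
  rw [integral_const_mul, Measure.integral_comp_mul_left (heatKernel 1 r), hφ] at key
  simp only [Complex.ofReal_zero, holoSymb, sinhc_zero, Complex.cosh_zero, Complex.real_smul,
    abs_of_pos (inv_pos.2 Real.two_pi_pos)] at key
  push_cast at key ⊢
  have hp : (Real.pi : ℂ) ≠ 0 := by exact_mod_cast Real.pi_ne_zero
  simp only [div_one, mul_one] at key
  rw [← key]
  field_simp; ring

lemma abs_kern_one_le (q : Heis) : |kern 1 q| ≤ kernBound *
    (Real.exp (-(Real.cos 1 / 4) * x q ^ 2) *
      (Real.exp (-(Real.cos 1 / 4) * y q ^ 2) * Real.exp (-|z q|))) := by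
  refine (Complex.abs_re_le_norm _).trans ((norm_heatKernel_one_le _ _).trans_eq ?_)
  rw [radius_sq, ← Real.exp_add, ← Real.exp_add, ← Real.exp_add]
  ring_nf

lemma integrable_kern_one : Integrable (kern 1) := by
  have hc : 0 < Real.cos 1 / 4 := by linarith [Real.cos_one_pos]
  have h := ((integrable_exp_neg_mul_sq hc).mul_prod
    ((integrable_exp_neg_mul_sq hc).mul_prod integrable_exp_neg_abs)).const_mul kernBound
  exact h.mono' (continuous_kern one_pos).aestronglyMeasurable (ae_of_all _ abs_kern_one_le)

lemma integral_kern_one_slice (a b : ℝ) : ∫ c : ℝ, kern 1 (a, b, c) =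
    1 / (4 * Real.pi) * (Real.exp (-(1 / 4) * a ^ 2) * Real.exp (-(1 / 4) * b ^ 2)) := by
  have h := integral_heatKernel_one (radius (a, b, 0))
  have h2 : ∫ c : ℝ, kern 1 (a, b, c) = (∫ c : ℝ, heatKernel 1 (radius (a, b, 0)) c).re := by
    have hk : ∀ c : ℝ, kern 1 (a, b, c) =
        Complex.reCLM (heatKernel 1 (radius (a, b, 0)) c) := fun c => by
      rw [kern, show radius (a, b, c) = radius (a, b, 0) from rfl]; rfl
    simp_rw [hk]
    rw [Complex.reCLM.integral_comp_comm (integrable_heatKernel_one _)]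
    rfl
  rw [h2, h, Complex.ofReal_re, radius_sq, ← Real.exp_add]
  simp only [x, y]
  ring_nf

lemma integral_kern_one : ∫ q, kern 1 q = 1 := by
  have h1 := integral_prod (kern 1) integrable_kern_one
  have h2 : ∀ᵐ a : ℝ, ∫ q : ℝ × ℝ, kern 1 (a, q) = ∫ b : ℝ, ∫ c : ℝ, kern 1 (a, b, c) := by
    filter_upwards [integrable_kern_one.prod_right_ae] with a ha
    exact integral_prod (fun q : ℝ × ℝ => kern 1 (a, q)) ha
  refine h1.trans ?_
  rw [integral_congr_ae h2]
  simp_rw [integral_kern_one_slice, integral_const_mul, integral_mul_const, integral_gaussian]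
  rw [← Real.sqrt_mul_self (by positivity : (0 : ℝ) ≤ Real.pi / (1 / 4)),
    Real.sqrt_mul_self (by positivity : (0 : ℝ) ≤ Real.pi / (1 / 4)),
    Real.mul_self_sqrt (by positivity)]
  field_simp

/-- The dilations of the Heisenberg group. -/
noncomputable def dil (s : ℝ) (q : Heis) : Heis := (s * x q, s * y q, s ^ 2 * z q)

lemma kern_dil {t : ℝ} (ht : 0 < t) (q : Heis) :
    kern t (dil (Real.sqrt t) q) = (t ^ 2)⁻¹ * kern 1 q := by
  have h0 := Real.sqrt_pos.2 ht
  have hr : radius (dil (Real.sqrt t) q) = Real.sqrt t * radius q := by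
    rw [radius, radius, ← Real.sqrt_sq h0.le, ← Real.sqrt_mul (sq_nonneg _), Real.sqrt_sq h0.le]
    congr 1; simp only [dil, x, y]; ring
  have hz : z (dil (Real.sqrt t) q) = t * z q := by
    simp [dil, z, Real.sq_sqrt ht.le]
  rw [kern, kern, heatKernel_scale ht, Complex.re_ofReal_mul, hr, hz, mul_div_cancel_left₀ _ h0.ne',
    mul_div_cancel_left₀ _ ht.ne']

lemma map_dil {s : ℝ} (hs : 0 < s) :
    Measure.map (dil s) volume = ENNReal.ofReal ((s ^ 4)⁻¹) • (volume : Measure Heis) := by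
  have h1 : ∀ c : ℝ, 0 < c → Measure.map (c * ·) (volume : Measure ℝ) =
      ENNReal.ofReal c⁻¹ • volume := fun c hc => by
    rw [Real.map_volume_mul_left hc.ne', abs_of_pos (inv_pos.2 hc)]
  have h2 : dil s = Prod.map (s * ·) (Prod.map (s * ·) (s ^ 2 * ·)) := rfl
  rw [h2, Measure.volume_eq_prod, Measure.volume_eq_prod,
    ← Measure.map_prod_map _ _ (by fun_prop) (by fun_prop),
    ← Measure.map_prod_map _ _ (by fun_prop) (by fun_prop), h1 s hs, h1 _ (pow_pos hs 2)]
  simp only [Measure.prod_smul_left, Measure.prod_smul_right, smul_smul]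
  congr 1
  rw [← ENNReal.ofReal_mul (by positivity), ← ENNReal.ofReal_mul (by positivity)]
  congr 1; field_simp

lemma continuous_dil_prod : Continuous fun a : ℝ × Heis => dil a.1 a.2 := by
  have := continuous_x
  have := continuous_y
  have := continuous_z
  unfold dil; fun_prop

lemma integral_kern_mul {t : ℝ} (ht : 0 < t) {g : Heis → ℝ} (hg : Continuous g) :
    ∫ q, kern t q * g q = ∫ q, kern 1 q * g (dil (Real.sqrt t) q) := by
  have h0 := Real.sqrt_pos.2 ht
  have hm : AEMeasurable (dil (Real.sqrt t)) :=
    (continuous_dil_prod.comp (Continuous.prodMk_right _)).measurable.aemeasurable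
  have hk := continuous_kern ht
  have h := integral_map hm (f := fun q => kern t q * g q) (by fun_prop)
  rw [map_dil h0, integral_smul_measure, ENNReal.toReal_ofReal (by positivity),
    show Real.sqrt t ^ 4 = t ^ 2 by
      rw [show Real.sqrt t ^ 4 = (Real.sqrt t ^ 2) ^ 2 by ring, Real.sq_sqrt ht.le]] at h
  simp only [kern_dil ht, mul_assoc, integral_const_mul, smul_eq_mul] at h
  exact mul_left_cancel₀ (by positivity) h

/-- The direction of `X` at `p`. -/
noncomputable def dirX (p : Heis) : Heis := (1, 0, -(y p) / 2)

/-- The direction of `Y` at `p`. -/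
noncomputable def dirY (p : Heis) : Heis := (0, 1, x p / 2)

lemma dirX_line (p : Heis) (s : ℝ) : dirX (p + s • dirX p) = dirX p := by
  simp [dirX, y]

lemma dirY_line (p : Heis) (s : ℝ) : dirY (p + s • dirY p) = dirY p := by
  simp [dirY, x]

lemma hasDerivAt_comp_line {u : Heis → ℝ} (hu : Differentiable ℝ u) (p v : Heis) (s : ℝ) :
    HasDerivAt (fun s : ℝ => u (p + s • v)) (fderiv ℝ u (p + s • v) v) s := by
  have h : HasDerivAt (fun s : ℝ => p + s • v) v s := by
    simpa using ((hasDerivAt_id s).smul_const v).const_add p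
  exact (hu (p + s • v)).hasFDerivAt.comp_hasDerivAt s h

lemma hasDerivAt_lineX {u : Heis → ℝ} (hu : Differentiable ℝ u) (p : Heis) (s : ℝ) :
    HasDerivAt (fun s : ℝ => u (p + s • dirX p)) (fieldX u (p + s • dirX p)) s := by
  have h : fieldX u (p + s • dirX p) = fderiv ℝ u (p + s • dirX p) (dirX (p + s • dirX p)) := rfl
  rw [h, dirX_line]
  exact hasDerivAt_comp_line hu p (dirX p) s

lemma hasDerivAt_lineY {u : Heis → ℝ} (hu : Differentiable ℝ u) (p : Heis) (s : ℝ) :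
    HasDerivAt (fun s : ℝ => u (p + s • dirY p)) (fieldY u (p + s • dirY p)) s := by
  have h : fieldY u (p + s • dirY p) = fderiv ℝ u (p + s • dirY p) (dirY (p + s • dirY p)) := rfl
  rw [h, dirY_line]
  exact hasDerivAt_comp_line hu p (dirY p) s

lemma contDiff_x {n : WithTop ℕ∞} : ContDiff ℝ n x := contDiff_fst
lemma contDiff_y {n : WithTop ℕ∞} : ContDiff ℝ n y := contDiff_fst.comp contDiff_snd
lemma contDiff_z {n : WithTop ℕ∞} : ContDiff ℝ n z := contDiff_snd.comp contDiff_snd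

lemma contDiff_fieldX {u : Heis → ℝ} {n m : WithTop ℕ∞} (hu : ContDiff ℝ n u) (h : m + 1 ≤ n) :
    ContDiff ℝ m (fieldX u) := by
  have := contDiff_y (n := m)
  have h1 := hu.fderiv_right h
  unfold fieldX
  exact h1.clm_apply (by fun_prop)

lemma contDiff_fieldY {u : Heis → ℝ} {n m : WithTop ℕ∞} (hu : ContDiff ℝ n u) (h : m + 1 ≤ n) :
    ContDiff ℝ m (fieldY u) := by
  have := contDiff_x (n := m)
  have h1 := hu.fderiv_right h
  unfold fieldY
  exact h1.clm_apply (by fun_prop)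

lemma differentiable_fieldX {u : Heis → ℝ} (hu : ContDiff ℝ 2 u) : Differentiable ℝ (fieldX u) :=
  (contDiff_fieldX (m := 1) hu (by norm_num)).differentiable one_ne_zero

lemma differentiable_fieldY {u : Heis → ℝ} (hu : ContDiff ℝ 2 u) : Differentiable ℝ (fieldY u) :=
  (contDiff_fieldY (m := 1) hu (by norm_num)).differentiable one_ne_zero

lemma deriv_deriv_nonpos_of_isLocalMax {g : ℝ → ℝ} {a : ℝ} (hg : ContinuousAt g a)
    (h : IsLocalMax g a) : deriv (deriv g) a ≤ 0 := by
  by_contra! hpos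
  have hmin := isLocalMin_of_deriv_deriv_pos hpos h.deriv_eq_zero hg
  have hconst : g =ᶠ[𝓝 a] fun _ => g a := by
    filter_upwards [h, hmin] with s h1 h2 using le_antisymm h1 h2
  rw [hconst.deriv.deriv_eq] at hpos
  simp at hpos

lemma second_deriv_nonpos_of_isLocalMax {g g' : ℝ → ℝ} {g'' a : ℝ} (h1 : ∀ s, HasDerivAt g (g' s) s)
    (h2 : HasDerivAt g' g'' a) (h : IsLocalMax g a) : g'' ≤ 0 := by
  have := deriv_deriv_nonpos_of_isLocalMax (h1 a).continuousAt h
  rwa [funext fun s => (h1 s).deriv, h2.deriv] at this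

lemma deriv_nonneg_of_forall_le_left {g : ℝ → ℝ} {d a b : ℝ} (hba : b < a) (hd : HasDerivAt g d a)
    (h : ∀ s ∈ Set.Ioo b a, g s ≤ g a) : 0 ≤ d := by
  have h1 : HasDerivWithinAt g d (Set.Iio a) a := hd.hasDerivWithinAt
  rw [hasDerivWithinAt_iff_tendsto_slope' (by simp)] at h1
  refine ge_of_tendsto h1 ?_
  filter_upwards [Ioo_mem_nhdsLT hba] with s hs
  rw [slope_def_field]
  exact div_nonneg_of_nonpos (by linarith [h s hs]) (by linarith [hs.2])

lemma norm_sq_le (p : Heis) : ‖p‖ ^ 2 ≤ x p ^ 2 + y p ^ 2 + z p ^ 2 := by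
  have h : ‖p‖ = max |x p| (max |y p| |z p|) := rfl
  rcases max_choice |x p| (max |y p| |z p|) with h1 | h1 <;> rw [h, h1]
  · rw [sq_abs]; nlinarith [sq_nonneg (y p), sq_nonneg (z p)]
  · rcases max_choice |y p| |z p| with h2 | h2 <;> rw [h2, sq_abs]
    · nlinarith [sq_nonneg (x p), sq_nonneg (z p)]
    · nlinarith [sq_nonneg (x p), sq_nonneg (y p)]

lemma IsHeatFlow.le_add_barrier {f : Heis → ℝ} {u v : ℝ → Heis → ℝ} (hu : IsHeatFlow f u)
    (hv : IsHeatFlow f v) {ε : ℝ} (hε : 0 < ε) {t : ℝ} (ht : 0 ≤ t) (p : Heis) :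
    u t p - v t p ≤ ε * (Real.exp t * (x p ^ 2 + y p ^ 2 + z p ^ 2 + 5)) := by
  by_contra! hlt
  obtain ⟨C, hC⟩ := hu.bounded
  obtain ⟨C', hC'⟩ := hv.bounded
  have hC0 : 0 ≤ C := (abs_nonneg _).trans (hC 0 le_rfl 0)
  have hC0' : 0 ≤ C' := (abs_nonneg _).trans (hC' 0 le_rfl 0)
  set w : ℝ × Heis → ℝ := fun a => u a.1 a.2 - v a.1 a.2 -
    ε * (Real.exp a.1 * (x a.2 ^ 2 + y a.2 ^ 2 + z a.2 ^ 2 + 5)) with hw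
  set R : ℝ := max ‖p‖ (Real.sqrt ((C + C') / ε)) with hR
  set K : Set (ℝ × Heis) := Set.Icc 0 t ×ˢ Metric.closedBall 0 R with hK
  have hpK : (t, p) ∈ K := ⟨⟨ht, le_rfl⟩, by simp [hR]⟩
  have hKc : IsCompact K := isCompact_Icc.prod (isCompact_closedBall _ _)
  have hKs : K ⊆ Set.Ici 0 ×ˢ Set.univ := fun a ha => ⟨ha.1.1, trivial⟩
  have hwc : ContinuousOn w K := by
    have hx := continuous_x
    have hy := continuous_y
    have hz := continuous_z
    refine ((hu.continuousOn.mono hKs).sub (hv.continuousOn.mono hKs)).sub ?_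
    exact Continuous.continuousOn (by fun_prop)
  obtain ⟨⟨s, q⟩, hsq, hmax⟩ := hKc.exists_isMaxOn ⟨_, hpK⟩ hwc
  have hwpos : 0 < w (s, q) := by
    have : w (t, p) ≤ w (s, q) := hmax hpK
    have h2 : 0 < w (t, p) := by simp only [hw]; linarith
    linarith
  have hs0 : 0 < s := by
    refine lt_of_le_of_ne hsq.1.1 ?_
    rintro rfl
    simp only [hw, hu.initial, hv.initial, sub_self, zero_sub] at hwpos
    have : 0 ≤ ε * (Real.exp 0 * (x q ^ 2 + y q ^ 2 + z q ^ 2 + 5)) := by positivity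
    linarith
  have hglob : ∀ s' ∈ Set.Icc 0 t, ∀ q', w (s', q') ≤ w (s, q) := by
    intro s' hs' q'
    by_cases hq' : q' ∈ Metric.closedBall (0 : Heis) R
    · exact hmax ⟨hs', hq'⟩
    · refine le_trans ?_ hwpos.le
      have h1 : R < ‖q'‖ := by simpa using hq'
      have h2 : Real.sqrt ((C + C') / ε) < ‖q'‖ := (le_max_right _ _).trans_lt h1
      have h3 : (C + C') / ε ≤ ‖q'‖ ^ 2 := by
        rw [← Real.sq_sqrt (div_nonneg (add_nonneg hC0 hC0') hε.le)]
        gcongr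
      rw [div_le_iff₀ hε] at h3
      have h4 := norm_sq_le q'
      have h5 : 1 ≤ Real.exp s' := Real.one_le_exp hs'.1
      have h6 := abs_le.1 (hC s' hs'.1 q')
      have h7 := abs_le.1 (hC' s' hs'.1 q')
      have h8 : x q' ^ 2 + y q' ^ 2 + z q' ^ 2 + 5 ≤
          Real.exp s' * (x q' ^ 2 + y q' ^ 2 + z q' ^ 2 + 5) :=
        le_mul_of_one_le_left (by positivity) h5
      simp only [hw]
      nlinarith
  -- the time derivative
  have htime : 0 ≤ (subLaplacian (u s) q - subLaplacian (v s) q) -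
      ε * (Real.exp s * (x q ^ 2 + y q ^ 2 + z q ^ 2 + 5)) := by
    refine deriv_nonneg_of_forall_le_left (g := fun s' => u s' q - v s' q -
      ε * (Real.exp s' * (x q ^ 2 + y q ^ 2 + z q ^ 2 + 5))) hs0 ?_
      fun s' hs' => hglob s' ⟨hs'.1.le, hs'.2.le.trans hsq.1.2⟩ q
    exact ((hu.equation s hs0 q).sub (hv.equation s hs0 q)).sub
      (((Real.hasDerivAt_exp s).mul_const _).const_mul ε)
  have hmaxline : ∀ d : Heis, IsLocalMax (fun r : ℝ => w (s, q + r • d)) 0 := fun d =>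
    Eventually.of_forall fun r => by simpa using hglob s hsq.1 (q + r • d)
  have hX : fieldX (fieldX (u s)) q - fieldX (fieldX (v s)) q -
      ε * (Real.exp s * (2 + y q ^ 2 / 2)) ≤ 0 := by
    refine second_deriv_nonpos_of_isLocalMax (a := 0)
      (g := fun r => u s (q + r • dirX q) - v s (q + r • dirX q) -
        ε * (Real.exp s * (x (q + r • dirX q) ^ 2 + y (q + r • dirX q) ^ 2 +
          z (q + r • dirX q) ^ 2 + 5)))
      (g' := fun r => fieldX (u s) (q + r • dirX q) - fieldX (v s) (q + r • dirX q) -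
        ε * (Real.exp s * (2 * (x q + r) - y q * (z q - r * y q / 2))))
      (fun r => ?_) ?_ (hmaxline (dirX q))
    · refine ((hasDerivAt_lineX ((hu.contDiff s hs0).differentiable two_ne_zero) q r).sub
        (hasDerivAt_lineX ((hv.contDiff s hs0).differentiable two_ne_zero) q r)).sub
        (HasDerivAt.const_mul _ (HasDerivAt.const_mul _ ?_))
      have : (fun r : ℝ => x (q + r • dirX q) ^ 2 + y (q + r • dirX q) ^ 2 +
          z (q + r • dirX q) ^ 2 + 5) = fun r =>
          (x q + r) ^ 2 + y q ^ 2 + (z q - r * y q / 2) ^ 2 + 5 := by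
        ext r; simp [x, y, z, dirX]; ring
      rw [this]
      have h1 := (((hasDerivAt_id r).const_add (x q)).pow 2).add_const (y q ^ 2)
      have h2 := ((((hasDerivAt_id r).mul_const (y q)).div_const 2).const_sub (z q)).pow 2
      convert! (h1.add h2).add_const 5 using 1
      simp; ring
    · have h1 := hasDerivAt_lineX (differentiable_fieldX (hu.contDiff s hs0)) q 0
      have h2 := hasDerivAt_lineX (differentiable_fieldX (hv.contDiff s hs0)) q 0
      rw [zero_smul, add_zero] at h1 h2
      refine (h1.sub h2).sub (HasDerivAt.const_mul _ (HasDerivAt.const_mul _ ?_))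
      have h3 := ((hasDerivAt_id (0 : ℝ)).const_add (x q)).const_mul 2
      have h4 := ((((hasDerivAt_id (0 : ℝ)).mul_const (y q)).div_const 2).const_sub (z q)).const_mul
        (y q)
      convert! h3.sub h4 using 1
      ring
  have hY : fieldY (fieldY (u s)) q - fieldY (fieldY (v s)) q -
      ε * (Real.exp s * (2 + x q ^ 2 / 2)) ≤ 0 := by
    refine second_deriv_nonpos_of_isLocalMax (a := 0)
      (g := fun r => u s (q + r • dirY q) - v s (q + r • dirY q) -
        ε * (Real.exp s * (x (q + r • dirY q) ^ 2 + y (q + r • dirY q) ^ 2 +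
          z (q + r • dirY q) ^ 2 + 5)))
      (g' := fun r => fieldY (u s) (q + r • dirY q) - fieldY (v s) (q + r • dirY q) -
        ε * (Real.exp s * (2 * (y q + r) + x q * (z q + r * x q / 2))))
      (fun r => ?_) ?_ (hmaxline (dirY q))
    · refine ((hasDerivAt_lineY ((hu.contDiff s hs0).differentiable two_ne_zero) q r).sub
        (hasDerivAt_lineY ((hv.contDiff s hs0).differentiable two_ne_zero) q r)).sub
        (HasDerivAt.const_mul _ (HasDerivAt.const_mul _ ?_))
      have : (fun r : ℝ => x (q + r • dirY q) ^ 2 + y (q + r • dirY q) ^ 2 +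
          z (q + r • dirY q) ^ 2 + 5) = fun r =>
          (y q + r) ^ 2 + x q ^ 2 + (z q + r * x q / 2) ^ 2 + 5 := by
        ext r; simp [x, y, z, dirY]; ring
      rw [this]
      have h1 := (((hasDerivAt_id r).const_add (y q)).pow 2).add_const (x q ^ 2)
      have h2 := ((((hasDerivAt_id r).mul_const (x q)).div_const 2).const_add (z q)).pow 2
      convert! (h1.add h2).add_const 5 using 1
      simp; ring
    · have h1 := hasDerivAt_lineY (differentiable_fieldY (hu.contDiff s hs0)) q 0
      have h2 := hasDerivAt_lineY (differentiable_fieldY (hv.contDiff s hs0)) q 0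
      rw [zero_smul, add_zero] at h1 h2
      refine (h1.sub h2).sub (HasDerivAt.const_mul _ (HasDerivAt.const_mul _ ?_))
      have h3 := ((hasDerivAt_id (0 : ℝ)).const_add (y q)).const_mul 2
      have h4 := ((((hasDerivAt_id (0 : ℝ)).mul_const (x q)).div_const 2).const_add (z q)).const_mul
        (x q)
      convert! h3.add h4 using 1
      ring
  simp only [subLaplacian] at htime
  have hpos : 0 < ε * (Real.exp s * (x q ^ 2 / 2 + y q ^ 2 / 2 + z q ^ 2 + 1)) := by positivity
  nlinarith

lemma IsHeatFlow.le {f : Heis → ℝ} {u v : ℝ → Heis → ℝ} (hu : IsHeatFlow f u)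
    (hv : IsHeatFlow f v) {t : ℝ} (ht : 0 ≤ t) (p : Heis) : u t p ≤ v t p := by
  have hc : 0 < Real.exp t * (x p ^ 2 + y p ^ 2 + z p ^ 2 + 5) := by positivity
  refine le_of_forall_pos_le_add fun δ hδ => ?_
  have := hu.le_add_barrier hv (div_pos hδ hc) ht p
  rw [div_mul_cancel₀ _ hc.ne'] at this
  linarith

theorem IsHeatFlow.unique {f : Heis → ℝ} {u v : ℝ → Heis → ℝ} (hu : IsHeatFlow f u)
    (hv : IsHeatFlow f v) {t : ℝ} (ht : 0 ≤ t) : u t = v t :=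
  funext fun p => le_antisymm (hu.le hv ht p) (hv.le hu ht p)

/-- The group law of the Heisenberg group. -/
noncomputable def gmul (p q : Heis) : Heis :=
  (x p + x q, y p + y q, z p + z q + (x p * y q - y p * x q) / 2)

lemma gmul_assoc (p q r : Heis) : gmul (gmul p q) r = gmul p (gmul q r) := by
  simp only [gmul, x, y, z, Prod.mk.injEq]
  refine ⟨by ring, by ring, by ring⟩

lemma gmul_neg_cancel_left (p q : Heis) : gmul (-p) (gmul p q) = q := by
  simp only [gmul, x, y, z]
  ext <;> simp
  ring

lemma gmul_cancel_neg_left (p q : Heis) : gmul p (gmul (-p) q) = q := by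
  simpa using gmul_neg_cancel_left (-p) q

lemma zero_gmul (q : Heis) : gmul 0 q = q := by
  simp only [gmul, x, y, z]
  ext <;> simp

lemma gmul_zero (p : Heis) : gmul p 0 = p := by
  simp only [gmul, x, y, z]
  ext <;> simp

lemma contDiff_gmul {n : WithTop ℕ∞} : ContDiff ℝ n fun a : Heis × Heis => gmul a.1 a.2 := by
  have := contDiff_x (n := n)
  have := contDiff_y (n := n)
  have := contDiff_z (n := n)
  unfold gmul; fun_prop

lemma continuous_gmul : Continuous fun a : Heis × Heis => gmul a.1 a.2 :=
  (contDiff_gmul (n := 0)).continuous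

lemma continuous_gmul_left (p : Heis) : Continuous (gmul p) :=
  continuous_gmul.comp (Continuous.prodMk_right p)

lemma measurePreserving_gmul (p : Heis) : MeasurePreserving (gmul p) volume volume := by
  have h : ∀ a b : ℝ, MeasurePreserving (fun q : ℝ × ℝ => (b + q.1, z p + q.2 +
      (x p * q.1 - b * a) / 2)) volume volume := by
    intro a b
    have := (measurePreserving_add_left (volume : Measure ℝ) b).skew_product
      (μc := (volume : Measure ℝ)) (μd := (volume : Measure ℝ))
      (g := fun c d => z p + d + (x p * c - b * a) / 2) (by fun_prop) (ae_of_all _ fun c => ?_)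
    · exact this
    · have := (measurePreserving_add_right (volume : Measure ℝ) (z p + (x p * c - b * a) / 2)).map_eq
      convert this using 2
      ext d; ring
  have := (measurePreserving_add_left (volume : Measure ℝ) (x p)).skew_product
      (μc := (volume : Measure (ℝ × ℝ))) (μd := (volume : Measure (ℝ × ℝ)))
      (g := fun a q => (y p + q.1, z p + q.2 + (x p * q.1 - y p * a) / 2)) (by fun_prop)
      (ae_of_all _ fun a => (h a (y p)).map_eq)
  exact this

lemma integral_comp_gmul {E : Type*} [NormedAddCommGroup E] [NormedSpace ℝ E] (p : Heis)
    (F : Heis → E) : ∫ q, F (gmul p q) = ∫ q, F q := by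
  refine (measurePreserving_gmul p).integral_comp ?_ F
  exact (Homeomorph.mk (Equiv.mk (gmul p) (gmul (-p)) (gmul_neg_cancel_left p)
    (gmul_cancel_neg_left p)) (continuous_gmul_left p)
    (continuous_gmul_left (-p))).measurableEmbedding

/-- The bounded solution of the heat equation issued from `f`. -/
noncomputable def flow (f : Heis → ℝ) (t : ℝ) (p : Heis) : ℝ :=
  ∫ q, kern 1 q * f (gmul p (dil (Real.sqrt t) q))

lemma flow_eq {f : Heis → ℝ} (hf : Continuous f) {t : ℝ} (ht : 0 < t) (p : Heis) :
    flow f t p = ∫ q, kern t q * f (gmul p q) :=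
  (integral_kern_mul ht (hf.comp (continuous_gmul_left p))).symm

lemma flow_zero (f : Heis → ℝ) : flow f 0 = f := by
  ext p
  have h : ∀ q, dil (Real.sqrt 0) q = 0 := fun q => by simp [dil]
  simp only [flow, h, gmul_zero, integral_mul_const, integral_kern_one, one_mul]

lemma flow_gmul {f : Heis → ℝ} (hf : Continuous f) {t : ℝ} (ht : 0 < t) (p e : Heis) :
    flow f t (gmul p e) = ∫ q, kern t (gmul (-e) q) * f (gmul p q) := by
  rw [flow_eq hf ht,
    ← integral_comp_gmul e (fun q => kern t (gmul (-e) q) * f (gmul p q))]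
  simp only [gmul_neg_cancel_left, gmul_assoc]

lemma norm_kern_mul_le {f : Heis → ℝ} {C : ℝ} (hC : ∀ p, |f p| ≤ C) (q p : Heis) :
    ‖kern 1 q * f p‖ ≤ |kern 1 q| * C := by
  rw [norm_mul, Real.norm_eq_abs, Real.norm_eq_abs]
  exact mul_le_mul_of_nonneg_left (hC p) (abs_nonneg _)

lemma abs_flow_le {f : Heis → ℝ} {C : ℝ} (hC : ∀ p, |f p| ≤ C) (t : ℝ) (p : Heis) :
    |flow f t p| ≤ (∫ q, |kern 1 q|) * C := by
  rw [← integral_mul_const]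
  exact norm_integral_le_of_norm_le (integrable_kern_one.abs.mul_const C)
    (ae_of_all _ fun q => norm_kern_mul_le hC _ _)

lemma continuous_flow {f : Heis → ℝ} (hf : Continuous f) {C : ℝ} (hC : ∀ p, |f p| ≤ C) :
    Continuous fun a : ℝ × Heis => flow f a.1 a.2 := by
  have hd : Continuous fun b : (ℝ × Heis) × Heis =>
      f (gmul b.1.2 (dil (Real.sqrt b.1.1) b.2)) := by
    refine hf.comp (continuous_gmul.comp (Continuous.prodMk (by fun_prop) ?_))
    exact continuous_dil_prod.comp (f := fun b : (ℝ × Heis) × Heis => (Real.sqrt b.1.1, b.2))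
      (by fun_prop)
  refine continuous_of_dominated (bound := fun q => |kern 1 q| * C) (fun a => ?_)
    (fun a => ae_of_all _ fun q => norm_kern_mul_le hC _ _) (integrable_kern_one.abs.mul_const C)
    (ae_of_all _ fun q => ?_)
  · have h1 := continuous_kern one_pos
    have h2 := hd.comp (Continuous.prodMk_right a)
    exact (h1.mul h2).aestronglyMeasurable
  · exact continuous_const.mul (hd.comp (Continuous.prodMk_left q))

lemma contDiff_flow {f : Heis → ℝ} (hf : ContDiff ℝ 2 f) (hfc : HasCompactSupport f) {t : ℝ}
    (ht : 0 < t) : ContDiff ℝ 2 (flow f t) := by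
  rw [contDiff_iff_contDiffAt]
  intro p₀
  set R : ℝ := ‖p₀‖ + 1
  set g : Heis → Heis → ℝ := fun p v => f (gmul p (-v)) with hg
  set k : Set Heis := (fun a : Heis × Heis => -gmul (-a.1) a.2) ''
    (Metric.closedBall 0 R ×ˢ tsupport f) with hk
  have hkc : IsCompact k := by
    refine ((isCompact_closedBall _ _).prod hfc).image ?_
    exact (continuous_gmul.comp (f := fun a : Heis × Heis => (-a.1, a.2)) (by fun_prop)).neg
  have hsupp : ∀ p v, p ∈ Metric.ball (0 : Heis) R → v ∉ k → g p v = 0 := by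
    intro p v hp hv
    by_contra h
    refine hv ⟨(p, gmul p (-v)), ⟨Metric.ball_subset_closedBall hp, subset_tsupport _ h⟩, ?_⟩
    simp [gmul_neg_cancel_left]
  have hgs : ContDiffOn ℝ ((2 : ℕ∞) : WithTop ℕ∞) (Function.uncurry g)
      (Metric.ball 0 R ×ˢ Set.univ) := by
    refine ContDiff.contDiffOn (hf.comp ?_)
    exact contDiff_gmul.comp (f := fun a : Heis × Heis => (a.1, -a.2)) (by fun_prop)
  have hconv := contDiffOn_convolution_right_with_param_comp (μ := (volume : Measure Heis))
    (ContinuousLinearMap.mul ℝ ℝ) (v := fun _ : Heis => (0 : Heis)) contDiffOn_const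
    Metric.isOpen_ball hkc hsupp (continuous_kern ht).locallyIntegrable hgs
  have heq : flow f t = fun p => (convolution (kern t) (g p) (ContinuousLinearMap.mul ℝ ℝ)
      (volume : Measure Heis)) 0 := by
    ext p
    rw [flow_eq hf.continuous ht]
    simp [convolution, hg]
  rw [heq]
  exact hconv.contDiffAt (Metric.isOpen_ball.mem_nhds (by simp [R]))

lemma ae_snd_ne_zero : ∀ᵐ a : Heis × ℝ, a.2 ≠ 0 :=
  Measure.quasiMeasurePreserving_snd.ae ae_ne_zero

lemma integrable_mul_of_bound {Φ : Heis × ℝ → ℂ} {g : Heis → ℂ} (hg : Continuous g)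
    (hgc : HasCompactSupport g) {bound : ℝ → ℝ} (hb : Integrable bound)
    (hm : AEStronglyMeasurable Φ)
    (hΦ : ∀ q ∈ tsupport g, ∀ l ≠ 0, ‖Φ (q, l)‖ ≤ bound l) :
    Integrable fun a : Heis × ℝ => Φ a * g a.1 := by
  have h := (hg.integrable_of_hasCompactSupport hgc (μ := volume)).norm.mul_prod hb
  refine h.mono' (hm.mul (by fun_prop)) ?_
  filter_upwards [ae_snd_ne_zero] with a ha
  rw [norm_mul, mul_comm]
  by_cases hq : a.1 ∈ tsupport g
  · exact mul_le_mul_of_nonneg_left (hΦ a.1 hq a.2 ha) (norm_nonneg _)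
  · simp [image_eq_zero_of_notMem_tsupport hq]

lemma hasDerivAt_integral_mul {Φ Φ' : ℝ → Heis × ℝ → ℂ} {g : Heis → ℂ} (hg : Continuous g)
    (hgc : HasCompactSupport g) {s₀ : ℝ} {S : Set ℝ} (hS : S ∈ 𝓝 s₀) {bound₀ bound : ℝ → ℝ}
    (hb₀ : Integrable bound₀) (hb : Integrable bound)
    (hm : ∀ s, AEStronglyMeasurable (Φ s)) (hm' : AEStronglyMeasurable (Φ' s₀))
    (hΦ : ∀ q ∈ tsupport g, ∀ l ≠ 0, ‖Φ s₀ (q, l)‖ ≤ bound₀ l)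
    (hΦ' : ∀ s ∈ S, ∀ q ∈ tsupport g, ∀ l ≠ 0, ‖Φ' s (q, l)‖ ≤ bound l)
    (hd : ∀ s ∈ S, ∀ q, ∀ l ≠ 0, HasDerivAt (fun s => Φ s (q, l)) (Φ' s (q, l)) s) :
    Integrable (fun a : Heis × ℝ => Φ' s₀ a * g a.1) ∧
      HasDerivAt (fun s => ∫ a : Heis × ℝ, Φ s a * g a.1)
        (∫ a : Heis × ℝ, Φ' s₀ a * g a.1) s₀ := by
  have h := (hg.integrable_of_hasCompactSupport hgc (μ := volume)).norm.mul_prod hb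
  refine hasDerivAt_integral_of_dominated_loc_of_deriv_le (F' := fun s a => Φ' s a * g a.1) hS
    (Eventually.of_forall fun s => (hm s).mul (by fun_prop))
    (integrable_mul_of_bound hg hgc hb₀ (hm s₀) hΦ) (hm'.mul (by fun_prop)) ?_ h ?_
  · filter_upwards [ae_snd_ne_zero] with a ha s hs
    rw [norm_mul, mul_comm]
    by_cases hq : a.1 ∈ tsupport g
    · exact mul_le_mul_of_nonneg_left (hΦ' s hs a.1 hq a.2 ha) (norm_nonneg _)
    · simp [image_eq_zero_of_notMem_tsupport hq]
  · filter_upwards [ae_snd_ne_zero] with a ha s hs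
    exact (hd s hs a.1 a.2 ha).mul_const _

/-- The integrand of the heat kernel on the group. -/
noncomputable def mehler (t : ℝ) (q : Heis) (l : ℝ) : ℂ :=
  Complex.exp (Complex.I * l * z q) * (symb t (radius q) l : ℂ)

/-- The integrand of the heat kernel along a horizontal line. -/
noncomputable def mehlerLine (t α β γ ζ l s : ℝ) : ℂ :=
  amp t l * Complex.exp (Complex.I * l * (ζ + s * α) - rate t l / 4 * ((β - s) ^ 2 + γ ^ 2))

/-- The logarithmic derivative of `mehlerLine`. -/
noncomputable def lineFactor (t α β l s : ℝ) : ℂ :=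
  Complex.I * l * α + rate t l * (β - s) / 2

lemma mehler_eq (t : ℝ) (q : Heis) (l : ℝ) : mehler t q l = amp t l *
    Complex.exp (Complex.I * l * z q - rate t l / 4 * (x q ^ 2 + y q ^ 2)) := by
  rw [mehler, symb, Complex.ofReal_mul, Complex.ofReal_exp, mul_left_comm, ← Complex.exp_add,
    radius_sq]
  congr 2; push_cast; ring

lemma mehler_lineX (t : ℝ) (q : Heis) (l s : ℝ) : mehler t (gmul (-(s, 0, 0)) q) l =
    mehlerLine t (-(y q) / 2) (x q) (y q) (z q) l s := by
  rw [mehler_eq, mehlerLine]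
  congr 2
  simp only [gmul, x, y, z]
  simp; ring

lemma mehler_lineY (t : ℝ) (q : Heis) (l s : ℝ) : mehler t (gmul (-(0, s, 0)) q) l =
    mehlerLine t (x q / 2) (y q) (x q) (z q) l s := by
  rw [mehler_eq, mehlerLine]
  congr 2
  simp only [gmul, x, y, z]
  simp; ring

lemma norm_mehlerLine_le {t : ℝ} (ht : 0 < t) (α β γ ζ l s : ℝ) :
    ‖mehlerLine t α β γ ζ l s‖ ≤ amp t l := by
  rw [mehlerLine, norm_mul, Complex.norm_real, Real.norm_of_nonneg (amp_nonneg ht l)]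
  refine mul_le_of_le_one_right (amp_nonneg ht l) ?_
  have : Complex.I * l * (ζ + s * α) - rate t l / 4 * ((β - s) ^ 2 + γ ^ 2) =
    Complex.I * (l * (ζ + s * α) : ℝ) - (rate t l / 4 * ((β - s) ^ 2 + γ ^ 2) : ℝ) := by
    push_cast; ring
  rw [this, Complex.norm_exp, Real.exp_le_one_iff]
  simp only [Complex.sub_re, Complex.re_mul_ofReal, Complex.I_re, zero_mul, Complex.ofReal_re]
  have := rate_nonneg ht l
  have : 0 ≤ rate t l / 4 * ((β - s) ^ 2 + γ ^ 2) := by positivity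
  linarith

lemma norm_mehler_le {t : ℝ} (ht : 0 < t) (q : Heis) (l : ℝ) : ‖mehler t q l‖ ≤ amp t l := by
  rw [mehler, norm_exp_mul_symb ht]; exact symb_le_amp ht _ _

lemma hasDerivAt_mehlerLine (t α β γ ζ l s : ℝ) :
    HasDerivAt (fun s => mehlerLine t α β γ ζ l s)
      (lineFactor t α β l s * mehlerLine t α β γ ζ l s) s := by
  have h1 : HasDerivAt (fun s : ℝ => (s : ℂ)) 1 s := Complex.ofRealCLM.hasDerivAt
  have h2 := ((h1.mul_const (α : ℂ)).const_add (ζ : ℂ)).const_mul (Complex.I * l)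
  have h3 := (((h1.const_sub (β : ℂ)).pow 2).add_const ((γ : ℂ) ^ 2)).const_mul
    ((rate t l : ℂ) / 4)
  convert! ((h2.sub h3).cexp).const_mul (amp t l : ℂ) using 1
  simp only [lineFactor, mehlerLine, Pi.sub_apply, Pi.pow_apply]
  push_cast; ring

lemma hasDerivAt_lineFactor (t α β l s : ℝ) :
    HasDerivAt (fun s => lineFactor t α β l s) (-(rate t l : ℂ) / 2) s := by
  have h1 : HasDerivAt (fun s : ℝ => (s : ℂ)) 1 s := Complex.ofRealCLM.hasDerivAt
  convert! (((h1.const_sub (β : ℂ)).const_mul (rate t l : ℂ)).div_const 2).const_add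
    (Complex.I * l * α) using 1
  ring

lemma norm_lineFactor_le {t M α β l s : ℝ} (ht : 0 < t) (hα : |α| ≤ M) (hβ : |β - s| ≤ M) :
    ‖lineFactor t α β l s‖ ≤ 2 * M * (|l| + 1 / t) := by
  have hM : 0 ≤ M := (abs_nonneg _).trans hα
  have h1 := rate_le ht l
  have h2 := rate_nonneg ht l
  have ht' : 0 < 1 / t := by positivity
  have h0 := abs_nonneg l
  refine (norm_add_le _ _).trans ?_
  have e : (rate t l : ℂ) * (β - s) / 2 = (rate t l * (β - s) / 2 : ℝ) := by push_cast; ring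
  rw [e, norm_mul, norm_mul, Complex.norm_I, one_mul, Complex.norm_real, Complex.norm_real,
    Complex.norm_real, Real.norm_eq_abs, Real.norm_eq_abs, Real.norm_eq_abs, abs_div, abs_mul,
    abs_of_nonneg h2, abs_two]
  have h3 : |l| * |α| ≤ (|l| + 1 / t) * M := by gcongr; linarith
  have h4 : rate t l * |β - s| ≤ (|l| + 1 / t) * M := by gcongr
  nlinarith [mul_nonneg (add_nonneg h0 ht'.le) hM]

lemma measurable_amp_snd (t : ℝ) : Measurable fun a : Heis × ℝ => amp t a.2 :=
  (measurable_amp t).comp measurable_snd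

lemma measurable_rate_snd (t : ℝ) : Measurable fun a : Heis × ℝ => rate t a.2 :=
  (measurable_rate t).comp measurable_snd

lemma measurable_mehlerLine (t s : ℝ) {α β γ : Heis → ℝ} (hα : Continuous α) (hβ : Continuous β)
    (hγ : Continuous γ) : Measurable fun a : Heis × ℝ =>
      mehlerLine t (α a.1) (β a.1) (γ a.1) (z a.1) a.2 s := by
  have h1 := measurable_amp_snd t
  have h2 := measurable_rate_snd t
  have h3 := continuous_z.measurable
  have h4 := hα.measurable
  have h5 := hβ.measurable
  have h6 := hγ.measurable
  unfold mehlerLine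
  fun_prop

lemma measurable_lineFactor (t s : ℝ) {α β : Heis → ℝ} (hα : Continuous α) (hβ : Continuous β) :
    Measurable fun a : Heis × ℝ => lineFactor t (α a.1) (β a.1) a.2 s := by
  have h2 := measurable_rate_snd t
  have h4 := hα.measurable
  have h5 := hβ.measurable
  unfold lineFactor
  fun_prop

lemma exists_abs_le_of_tsupport {g : Heis → ℂ} (hgc : HasCompactSupport g) {α : Heis → ℝ}
    (hα : Continuous α) : ∃ M, ∀ q ∈ tsupport g, |α q| ≤ M :=
  IsCompact.exists_bound_of_continuousOn hgc hα.continuousOn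

lemma amp_le' {t : ℝ} (ht : 0 < t) (l : ℝ) :
    amp t l ≤ 2 * (|l| + 1 / t) * Real.exp (-(|l| * t)) := by
  refine (amp_le ht l).trans ?_
  have : 0 < 1 / t := by positivity
  gcongr
  linarith

lemma exists_lineFactor_bound {g : Heis → ℂ} (hgc : HasCompactSupport g) {t : ℝ} (ht : 0 < t)
    {α β : Heis → ℝ} (hα : Continuous α) (hβ : Continuous β) (s₀ : ℝ) : ∃ M, 0 ≤ M ∧
    ∀ s ∈ Metric.ball s₀ 1, ∀ q ∈ tsupport g, ∀ l,
      ‖lineFactor t (α q) (β q) l s‖ ≤ M * (|l| + 1 / t) := by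
  obtain ⟨A, hA⟩ := exists_abs_le_of_tsupport hgc hα
  obtain ⟨B, hB⟩ := exists_abs_le_of_tsupport hgc hβ
  refine ⟨2 * (|A| + |B| + |s₀| + 1), by positivity, fun s hs q hq l => ?_⟩
  refine norm_lineFactor_le ht ?_ ?_
  · have := hA q hq
    have := le_abs_self A
    linarith [abs_nonneg B, abs_nonneg s₀]
  · have h1 := hB q hq
    have h2 := le_abs_self B
    have h3 := abs_sub (β q) s
    have h4 : |s - s₀| < 1 := hs
    have h5 := abs_sub_abs_le_abs_sub s s₀
    linarith [abs_nonneg A]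

variable {g : Heis → ℂ} {t : ℝ} {α β γ : Heis → ℝ}

lemma hasDerivAt_integral_mehlerLine (hg : Continuous g) (hgc : HasCompactSupport g) (ht : 0 < t)
    (hα : Continuous α) (hβ : Continuous β) (hγ : Continuous γ) (s₀ : ℝ) :
    Integrable (fun a : Heis × ℝ => lineFactor t (α a.1) (β a.1) a.2 s₀ *
      mehlerLine t (α a.1) (β a.1) (γ a.1) (z a.1) a.2 s₀ * g a.1) ∧
    HasDerivAt (fun s => ∫ a : Heis × ℝ,
        mehlerLine t (α a.1) (β a.1) (γ a.1) (z a.1) a.2 s * g a.1)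
      (∫ a : Heis × ℝ, lineFactor t (α a.1) (β a.1) a.2 s₀ *
        mehlerLine t (α a.1) (β a.1) (γ a.1) (z a.1) a.2 s₀ * g a.1) s₀ := by
  obtain ⟨M, hM, hb⟩ := exists_lineFactor_bound hgc ht hα hβ s₀
  refine hasDerivAt_integral_mul hg hgc (Metric.ball_mem_nhds s₀ one_pos) (integrable_amp ht)
    ((integrable_add_pow_mul_exp 2 (1 / t) ht).const_mul (2 * M))
    (Φ' := fun s a => lineFactor t (α a.1) (β a.1) a.2 s *
      mehlerLine t (α a.1) (β a.1) (γ a.1) (z a.1) a.2 s)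
    (fun s => (measurable_mehlerLine t s hα hβ hγ).aestronglyMeasurable)
    ((measurable_lineFactor t s₀ hα hβ).mul
      (measurable_mehlerLine t s₀ hα hβ hγ)).aestronglyMeasurable
    (fun q _ l _ => norm_mehlerLine_le ht _ _ _ _ _ _) (fun s hs q hq l _ => ?_)
    (fun s _ q l _ => hasDerivAt_mehlerLine t _ _ _ _ _ s)
  have h0 : 0 ≤ |l| + 1 / t := by positivity
  calc _ ≤ M * (|l| + 1 / t) * (2 * (|l| + 1 / t) * Real.exp (-(|l| * t))) := by
        rw [norm_mul]
        gcongr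
        · exact hb s hs q hq l
        · exact (norm_mehlerLine_le ht _ _ _ _ _ _).trans (amp_le' ht l)
    _ = _ := by ring

lemma hasDerivAt_integral_lineFactor_mul_mehlerLine (hg : Continuous g)
    (hgc : HasCompactSupport g) (ht : 0 < t)
    (hα : Continuous α) (hβ : Continuous β) (hγ : Continuous γ) (s₀ : ℝ) :
    Integrable (fun a : Heis × ℝ => (lineFactor t (α a.1) (β a.1) a.2 s₀ ^ 2 - rate t a.2 / 2) *
      mehlerLine t (α a.1) (β a.1) (γ a.1) (z a.1) a.2 s₀ * g a.1) ∧
    HasDerivAt (fun s => ∫ a : Heis × ℝ, lineFactor t (α a.1) (β a.1) a.2 s *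
        mehlerLine t (α a.1) (β a.1) (γ a.1) (z a.1) a.2 s * g a.1)
      (∫ a : Heis × ℝ, (lineFactor t (α a.1) (β a.1) a.2 s₀ ^ 2 - rate t a.2 / 2) *
        mehlerLine t (α a.1) (β a.1) (γ a.1) (z a.1) a.2 s₀ * g a.1) s₀ := by
  obtain ⟨M, hM, hb⟩ := exists_lineFactor_bound hgc ht hα hβ s₀
  have hr := (measurable_rate_snd t).complex_ofReal
  have hF := fun s => measurable_lineFactor t s hα hβ
  have hL := fun s => measurable_mehlerLine t s hα hβ hγ
  refine hasDerivAt_integral_mul hg hgc (Metric.ball_mem_nhds s₀ one_pos)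
    ((integrable_add_pow_mul_exp 2 (1 / t) ht).const_mul (2 * M))
    (((integrable_add_pow_mul_exp 3 (1 / t) ht).const_mul (2 * M ^ 2)).add
      (integrable_add_pow_mul_exp 2 (1 / t) ht))
    (Φ := fun s a => lineFactor t (α a.1) (β a.1) a.2 s *
      mehlerLine t (α a.1) (β a.1) (γ a.1) (z a.1) a.2 s)
    (Φ' := fun s a => (lineFactor t (α a.1) (β a.1) a.2 s ^ 2 - rate t a.2 / 2) *
      mehlerLine t (α a.1) (β a.1) (γ a.1) (z a.1) a.2 s)
    (fun s => ((hF s).mul (hL s)).aestronglyMeasurable)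
    (((((hF s₀).pow_const 2).sub (hr.div_const 2)).mul (hL s₀)).aestronglyMeasurable)
    (fun q hq l _ => ?_) (fun s hs q hq l _ => ?_)
    (fun s _ q l _ => ?_)
  · have h0 : 0 ≤ |l| + 1 / t := by positivity
    calc _ ≤ M * (|l| + 1 / t) * (2 * (|l| + 1 / t) * Real.exp (-(|l| * t))) := by
          rw [norm_mul]
          gcongr
          · exact hb s₀ (Metric.mem_ball_self one_pos) q hq l
          · exact (norm_mehlerLine_le ht _ _ _ _ _ _).trans (amp_le' ht l)
      _ = _ := by ring
  · have h0 : 0 ≤ |l| + 1 / t := by positivity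
    calc _ ≤ ((M * (|l| + 1 / t)) ^ 2 + (|l| + 1 / t) / 2) *
            (2 * (|l| + 1 / t) * Real.exp (-(|l| * t))) := by
          rw [norm_mul]
          gcongr
          · refine (norm_sub_le _ _).trans ?_
            rw [norm_pow]
            have e : ((rate t l : ℂ) / 2) = (rate t l / 2 : ℝ) := by push_cast; ring
            rw [e, Complex.norm_real, Real.norm_of_nonneg (by linarith [rate_nonneg ht l])]
            gcongr
            · exact hb s hs q hq l
            · exact rate_le ht l
          · exact (norm_mehlerLine_le ht _ _ _ _ _ _).trans (amp_le' ht l)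
      _ = _ := by simp only [Pi.add_apply]; ring
  · convert! (hasDerivAt_lineFactor t (α q) (β q) l s).mul
      (hasDerivAt_mehlerLine t (α q) (β q) (γ q) (z q) l s) using 1
    ring

/-- Left translation as a homeomorphism. -/
noncomputable def gmulHomeo (p : Heis) : Heis ≃ₜ Heis where
  toFun := gmul p
  invFun := gmul (-p)
  left_inv := gmul_neg_cancel_left p
  right_inv := gmul_cancel_neg_left p
  continuous_toFun := continuous_gmul_left p
  continuous_invFun := continuous_gmul_left (-p)

/-- The left translate of a function, with complex values. -/
noncomputable def translate (f : Heis → ℝ) (p q : Heis) : ℂ := f (gmul p q)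

lemma continuous_translate {f : Heis → ℝ} (hf : Continuous f) (p : Heis) :
    Continuous (translate f p) :=
  Complex.continuous_ofReal.comp (hf.comp (continuous_gmul_left p))

lemma hasCompactSupport_translate {f : Heis → ℝ} (hfc : HasCompactSupport f) (p : Heis) :
    HasCompactSupport (translate f p) :=
  (hfc.comp_homeomorph (gmulHomeo p)).comp_left (g := fun r : ℝ => (r : ℂ)) Complex.ofReal_zero

lemma measurable_mehler_gmul (t : ℝ) (e : Heis) :
    Measurable fun a : Heis × ℝ => mehler t (gmul e a.1) a.2 := by
  have h1 := measurable_amp_snd t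
  have h2 := measurable_rate_snd t
  have h3 : Measurable fun a : Heis × ℝ => z (gmul e a.1) :=
    (continuous_z.comp ((continuous_gmul_left e).comp continuous_fst)).measurable
  have h4 : Measurable fun a : Heis × ℝ => x (gmul e a.1) :=
    (continuous_x.comp ((continuous_gmul_left e).comp continuous_fst)).measurable
  have h5 : Measurable fun a : Heis × ℝ => y (gmul e a.1) :=
    (continuous_y.comp ((continuous_gmul_left e).comp continuous_fst)).measurable
  simp_rw [mehler_eq]
  fun_prop

lemma ofReal_flow_gmul {f : Heis → ℝ} (hf : Continuous f) (hfc : HasCompactSupport f) {t : ℝ}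
    (ht : 0 < t) (p e : Heis) : (flow f t (gmul p e) : ℂ) = 1 / (8 * (Real.pi : ℂ) ^ 2) *
      ∫ a : Heis × ℝ, mehler t (gmul (-e) a.1) a.2 * translate f p a.1 := by
  have e1 : ∫ a : Heis × ℝ, mehler t (gmul (-e) a.1) a.2 * translate f p a.1 =
      ∫ q : Heis, ∫ l : ℝ, mehler t (gmul (-e) q) l * translate f p q :=
    integral_prod _ (integrable_mul_of_bound (continuous_translate hf p)
      (hasCompactSupport_translate hfc p) (integrable_amp ht)
      (measurable_mehler_gmul t (-e)).aestronglyMeasurable fun q _ l _ => norm_mehler_le ht _ _)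
  rw [flow_gmul hf ht, ← integral_complex_ofReal, e1, ← integral_const_mul]
  congr 1; ext q
  rw [integral_mul_const, Complex.ofReal_mul, ofReal_kern, heatKernel_eq, mul_assoc]
  rfl

lemma gmul_horizontalX (p : Heis) (s : ℝ) : gmul p (s, 0, 0) = p + s • dirX p := by
  simp only [gmul, dirX, x, y, z]
  ext <;> simp
  ring

lemma gmul_horizontalY (p : Heis) (s : ℝ) : gmul p (0, s, 0) = p + s • dirY p := by
  simp only [gmul, dirY, x, y, z]
  ext <;> simp
  ring

section Space

variable {f : Heis → ℝ} (hf : ContDiff ℝ 2 f) (hfc : HasCompactSupport f) {t : ℝ} (ht : 0 < t)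
  (p : Heis)
include hf hfc ht

lemma ofReal_flow_lineX (s : ℝ) : (flow f t (p + s • dirX p) : ℂ) = 1 / (8 * (Real.pi : ℂ) ^ 2) *
    ∫ a : Heis × ℝ, mehlerLine t (-(y a.1) / 2) (x a.1) (y a.1) (z a.1) a.2 s *
      translate f p a.1 := by
  rw [← gmul_horizontalX, ofReal_flow_gmul hf.continuous hfc ht]
  simp_rw [mehler_lineX]

lemma ofReal_flow_lineY (s : ℝ) : (flow f t (p + s • dirY p) : ℂ) = 1 / (8 * (Real.pi : ℂ) ^ 2) *
    ∫ a : Heis × ℝ, mehlerLine t (x a.1 / 2) (y a.1) (x a.1) (z a.1) a.2 s *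
      translate f p a.1 := by
  rw [← gmul_horizontalY, ofReal_flow_gmul hf.continuous hfc ht]
  simp_rw [mehler_lineY]

lemma fieldX_flow_line (s : ℝ) : (fieldX (flow f t) (p + s • dirX p) : ℂ) =
    1 / (8 * (Real.pi : ℂ) ^ 2) * ∫ a : Heis × ℝ, lineFactor t (-(y a.1) / 2) (x a.1) a.2 s *
      mehlerLine t (-(y a.1) / 2) (x a.1) (y a.1) (z a.1) a.2 s * translate f p a.1 := by
  have hd := (contDiff_flow hf hfc ht).differentiable two_ne_zero
  have h1 := (hasDerivAt_lineX hd p s).ofReal_comp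
  simp_rw [ofReal_flow_lineX hf hfc ht p] at h1
  have hx := continuous_x
  have hy := continuous_y
  have h2 := (hasDerivAt_integral_mehlerLine (continuous_translate hf.continuous p)
    (hasCompactSupport_translate hfc p) ht (α := fun q => -(y q) / 2) (by fun_prop) hx hy s).2
  exact h1.unique (h2.const_mul _)

lemma fieldY_flow_line (s : ℝ) : (fieldY (flow f t) (p + s • dirY p) : ℂ) =
    1 / (8 * (Real.pi : ℂ) ^ 2) * ∫ a : Heis × ℝ, lineFactor t (x a.1 / 2) (y a.1) a.2 s *
      mehlerLine t (x a.1 / 2) (y a.1) (x a.1) (z a.1) a.2 s * translate f p a.1 := by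
  have hd := (contDiff_flow hf hfc ht).differentiable two_ne_zero
  have h1 := (hasDerivAt_lineY hd p s).ofReal_comp
  simp_rw [ofReal_flow_lineY hf hfc ht p] at h1
  have hx := continuous_x
  have hy := continuous_y
  have h2 := (hasDerivAt_integral_mehlerLine (continuous_translate hf.continuous p)
    (hasCompactSupport_translate hfc p) ht (α := fun q => x q / 2) (by fun_prop) hy hx s).2
  exact h1.unique (h2.const_mul _)

lemma fieldX_fieldX_flow :
    Integrable (fun a : Heis × ℝ =>
      (lineFactor t (-(y a.1) / 2) (x a.1) a.2 0 ^ 2 - rate t a.2 / 2) *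
      mehler t a.1 a.2 * translate f p a.1) ∧
    (fieldX (fieldX (flow f t)) p : ℂ) =
    1 / (8 * (Real.pi : ℂ) ^ 2) * ∫ a : Heis × ℝ,
      (lineFactor t (-(y a.1) / 2) (x a.1) a.2 0 ^ 2 - rate t a.2 / 2) *
      mehler t a.1 a.2 * translate f p a.1 := by
  have hd := differentiable_fieldX (contDiff_flow hf hfc ht)
  have h1 := (hasDerivAt_lineX hd p 0).ofReal_comp
  simp_rw [fieldX_flow_line hf hfc ht p] at h1
  have hx := continuous_x
  have hy := continuous_y
  have h2 := hasDerivAt_integral_lineFactor_mul_mehlerLine (continuous_translate hf.continuous p)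
    (hasCompactSupport_translate hfc p) ht (α := fun q => -(y q) / 2) (by fun_prop) hx hy 0
  have h3 : ∀ a : Heis × ℝ, mehlerLine t (-(y a.1) / 2) (x a.1) (y a.1) (z a.1) a.2 0 =
      mehler t a.1 a.2 := fun a => by
    rw [← mehler_lineX, show (-(0, 0, 0) : Heis) = 0 by simp, zero_gmul]
  simp_rw [h3] at h2
  refine ⟨h2.1, ?_⟩
  have := h1.unique (h2.2.const_mul _)
  rwa [zero_smul, add_zero] at this

lemma fieldY_fieldY_flow :
    Integrable (fun a : Heis × ℝ =>
      (lineFactor t (x a.1 / 2) (y a.1) a.2 0 ^ 2 - rate t a.2 / 2) *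
      mehler t a.1 a.2 * translate f p a.1) ∧
    (fieldY (fieldY (flow f t)) p : ℂ) =
    1 / (8 * (Real.pi : ℂ) ^ 2) * ∫ a : Heis × ℝ,
      (lineFactor t (x a.1 / 2) (y a.1) a.2 0 ^ 2 - rate t a.2 / 2) *
      mehler t a.1 a.2 * translate f p a.1 := by
  have hd := differentiable_fieldY (contDiff_flow hf hfc ht)
  have h1 := (hasDerivAt_lineY hd p 0).ofReal_comp
  simp_rw [fieldY_flow_line hf hfc ht p] at h1
  have hx := continuous_x
  have hy := continuous_y
  have h2 := hasDerivAt_integral_lineFactor_mul_mehlerLine (continuous_translate hf.continuous p)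
    (hasCompactSupport_translate hfc p) ht (α := fun q => x q / 2) (by fun_prop) hy hx 0
  have h3 : ∀ a : Heis × ℝ, mehlerLine t (x a.1 / 2) (y a.1) (x a.1) (z a.1) a.2 0 =
      mehler t a.1 a.2 := fun a => by
    rw [← mehler_lineY, show (-(0, 0, 0) : Heis) = 0 by simp, zero_gmul]
  simp_rw [h3] at h2
  refine ⟨h2.1, ?_⟩
  have := h1.unique (h2.2.const_mul _)
  rwa [zero_smul, add_zero] at this

lemma subLaplacian_flow : (subLaplacian (flow f t) p : ℂ) =
    1 / (8 * (Real.pi : ℂ) ^ 2) * ∫ a : Heis × ℝ,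
      ((radius a.1 ^ 2 / 4 * (rate t a.2 ^ 2 - a.2 ^ 2) - rate t a.2 : ℝ) : ℂ) *
      mehler t a.1 a.2 * translate f p a.1 := by
  obtain ⟨hX, eX⟩ := fieldX_fieldX_flow hf hfc ht p
  obtain ⟨hY, eY⟩ := fieldY_fieldY_flow hf hfc ht p
  rw [subLaplacian, Complex.ofReal_add, eX, eY, ← mul_add, ← integral_add hX hY]
  congr 2; ext a
  simp only [lineFactor, radius_sq]
  push_cast
  have := Complex.I_sq
  linear_combination (a.2 : ℂ) ^ 2 / 4 * (x a.1 ^ 2 + y a.1 ^ 2) * mehler t a.1 a.2 *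
    translate f p a.1 * this

end Space

lemma hasDerivAt_mehler {t l : ℝ} (ht : t ≠ 0) (hl : l ≠ 0) (q : Heis) :
    HasDerivAt (fun s => mehler s q l)
      (((radius q ^ 2 / 4 * (rate t l ^ 2 - l ^ 2) - rate t l : ℝ) : ℂ) * mehler t q l) t := by
  convert! ((hasDerivAt_symb ht hl (radius q)).ofReal_comp).const_mul
    (Complex.exp (Complex.I * l * z q)) using 1
  rw [mehler]; push_cast; ring

lemma amp_rate_le_of_half_lt {t s : ℝ} (ht : 0 < t) (hs : t / 2 < s) (l : ℝ) :
    amp s l ≤ 2 * (|l| + 2 / t) * Real.exp (-(|l| * (t / 2))) ∧ rate s l ≤ |l| + 2 / t := by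
  have hs0 : 0 < s := by linarith
  have h : 1 / s ≤ 2 / t := by
    rw [div_le_div_iff₀ hs0 ht]; linarith
  refine ⟨(amp_le' hs0 l).trans ?_, (rate_le hs0 l).trans (by linarith)⟩
  gcongr

lemma hasDerivAt_flow {f : Heis → ℝ} (hf : ContDiff ℝ 2 f) (hfc : HasCompactSupport f) {t : ℝ}
    (ht : 0 < t) (p : Heis) : HasDerivAt (fun s => flow f s p) (subLaplacian (flow f t) p) t := by
  have hg := continuous_translate hf.continuous p
  have hgc := hasCompactSupport_translate hfc p
  obtain ⟨M, hM⟩ := exists_abs_le_of_tsupport hgc continuous_radius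
  have hmeas : ∀ s, Measurable fun a : Heis × ℝ => mehler s a.1 a.2 := fun s => by
    simpa only [zero_gmul] using measurable_mehler_gmul s 0
  have hr := measurable_rate_snd t
  have hrad := continuous_radius.measurable
  have key := (hasDerivAt_integral_mul hg hgc (s₀ := t) (S := Set.Ioi (t / 2))
    (Ioi_mem_nhds (by linarith)) (integrable_amp ht)
    (((integrable_add_pow_mul_exp 3 (2 / t) (half_pos ht)).const_mul (M ^ 2 / 2)).add
      ((integrable_add_pow_mul_exp 2 (2 / t) (half_pos ht)).const_mul 2))
    (Φ := fun s a => mehler s a.1 a.2)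
    (Φ' := fun s a => ((radius a.1 ^ 2 / 4 * (rate s a.2 ^ 2 - a.2 ^ 2) - rate s a.2 : ℝ) : ℂ) *
      mehler s a.1 a.2)
    (fun s => (hmeas s).aestronglyMeasurable)
    (Measurable.aestronglyMeasurable (by have := hmeas t; fun_prop))
    (fun q _ l _ => norm_mehler_le ht q l) (fun s hs q hq l hl => ?_)
    (fun s hs q l hl => hasDerivAt_mehler (by
      have : t / 2 < s := hs
      linarith) hl q)).2
  · have h1 : HasDerivAt (fun s => (flow f s p : ℂ)) (subLaplacian (flow f t) p : ℂ) t := by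
      rw [subLaplacian_flow hf hfc ht p]
      refine (key.const_mul (1 / (8 * (Real.pi : ℂ) ^ 2))).congr_of_eventuallyEq ?_
      filter_upwards [Ioi_mem_nhds ht] with s hs
      have := ofReal_flow_gmul hf.continuous hfc hs p 0
      simpa only [gmul_zero, neg_zero, zero_gmul] using this
    simpa [Function.comp_def] using Complex.reCLM.hasFDerivAt.comp_hasDerivAt t h1
  · have hs' : t / 2 < s := hs
    have hs0 : 0 < s := by linarith
    obtain ⟨ha, hb⟩ := amp_rate_le_of_half_lt ht hs' l
    have h0 : 0 ≤ |l| + 2 / t := by positivity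
    have hr0 := rate_nonneg hs0 l
    have hMr : radius q ^ 2 ≤ M ^ 2 := by
      rw [← sq_abs (radius q)]; gcongr; exact hM q hq
    have hle : l ^ 2 ≤ rate s l ^ 2 := by
      rw [← sq_abs l]; gcongr; exact abs_le_rate hs0
    calc _ ≤ (M ^ 2 / 4 * (|l| + 2 / t) ^ 2 + (|l| + 2 / t)) *
            (2 * (|l| + 2 / t) * Real.exp (-(|l| * (t / 2)))) := by
          rw [norm_mul]
          gcongr
          · rw [Complex.norm_real]
            refine (norm_sub_le _ _).trans ?_
            rw [Real.norm_of_nonneg hr0, Real.norm_of_nonneg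
              (mul_nonneg (by positivity) (by linarith))]
            gcongr
            nlinarith [sq_nonneg l, mul_self_le_mul_self hr0 hb]
          · exact (norm_mehler_le hs0 q l).trans ha
      _ = _ := by simp only [Pi.add_apply]; ring

theorem isHeatFlow_flow {f : Heis → ℝ} (hf : ContDiff ℝ 2 f) (hfc : HasCompactSupport f) :
    IsHeatFlow f (flow f) := by
  obtain ⟨C, hC⟩ := hf.continuous.bounded_above_of_compact_support hfc
  exact ⟨flow_zero f, (continuous_flow hf.continuous hC).continuousOn,
    ⟨_, fun t _ p => abs_flow_le hC t p⟩, fun t ht => contDiff_flow hf hfc ht,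
    fun t ht p => hasDerivAt_flow hf hfc ht p⟩

lemma heatSemigroup_eq_flow {f : Heis → ℝ} (hf : ContDiff ℝ 2 f) (hfc : HasCompactSupport f)
    {t : ℝ} (ht : 0 ≤ t) : heatSemigroup t f = flow f t := by
  have h : ∃ u : ℝ → Heis → ℝ, IsHeatFlow f u := ⟨_, isHeatFlow_flow hf hfc⟩
  rw [heatSemigroup, dif_pos h]
  exact h.choose_spec.unique (isHeatFlow_flow hf hfc) ht

lemma isHeatFlow_heatSemigroup {f : Heis → ℝ} (hf : ContDiff ℝ 2 f) (hfc : HasCompactSupport f) :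
    IsHeatFlow f (fun t => heatSemigroup t f) := by
  have h : ∃ u : ℝ → Heis → ℝ, IsHeatFlow f u := ⟨_, isHeatFlow_flow hf hfc⟩
  have e : (fun t => heatSemigroup t f) = h.choose := by
    ext1 t; rw [heatSemigroup, dif_pos h]
  rw [e]
  exact h.choose_spec

lemma ofReal_heatSemigroup_zero {f : Heis → ℝ} (hf : ContDiff ℝ 2 f) (hfc : HasCompactSupport f)
    {t : ℝ} (ht : 0 < t) : ((heatSemigroup t f 0 : ℝ) : ℂ) =
      ∫ p : Heis, heatKernel t (radius p) (z p) * (f p : ℂ) := by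
  rw [heatSemigroup_eq_flow hf hfc ht.le, flow_eq hf.continuous ht, ← integral_complex_ofReal]
  simp only [zero_gmul, Complex.ofReal_mul, ofReal_kern]

lemma complexGradient_flow_zero {f : Heis → ℝ} (hf : ContDiff ℝ 2 f) (hfc : HasCompactSupport f)
    {t : ℝ} (ht : 0 < t) :
    Integrable (fun a : Heis × ℝ => (x a.1 + Complex.I * y a.1) * ((rate t a.2 - a.2) / 2) *
        mehler t a.1 a.2 * (f a.1 : ℂ)) ∧
    complexGradient (flow f t) 0 = 1 / (8 * (Real.pi : ℂ) ^ 2) *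
      ∫ a : Heis × ℝ, (x a.1 + Complex.I * y a.1) * ((rate t a.2 - a.2) / 2) *
        mehler t a.1 a.2 * (f a.1 : ℂ) := by
  have hx := continuous_x
  have hy := continuous_y
  have hg := continuous_translate hf.continuous 0
  have hgc := hasCompactSupport_translate hfc 0
  have eX := fieldX_flow_line hf hfc ht 0 0
  have eY := fieldY_flow_line hf hfc ht 0 0
  have iX := (hasDerivAt_integral_mehlerLine hg hgc ht (α := fun q => -(y q) / 2) (by fun_prop)
    hx hy 0).1
  have iY := (hasDerivAt_integral_mehlerLine hg hgc ht (α := fun q => x q / 2) (by fun_prop)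
    hy hx 0).1.const_mul Complex.I
  have key : ∀ a : Heis × ℝ,
      lineFactor t (-(y a.1) / 2) (x a.1) a.2 0 *
        mehlerLine t (-(y a.1) / 2) (x a.1) (y a.1) (z a.1) a.2 0 * translate f 0 a.1 +
      Complex.I * (lineFactor t (x a.1 / 2) (y a.1) a.2 0 *
        mehlerLine t (x a.1 / 2) (y a.1) (x a.1) (z a.1) a.2 0 * translate f 0 a.1) =
      (x a.1 + Complex.I * y a.1) * ((rate t a.2 - a.2) / 2) *
        mehler t a.1 a.2 * (f a.1 : ℂ) := fun a => by
    rw [← mehler_lineX, ← mehler_lineY, show (-(0, 0, 0) : Heis) = 0 by simp, zero_gmul, translate,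
      zero_gmul]
    simp only [lineFactor]
    push_cast
    linear_combination (a.2 : ℂ) * x a.1 / 2 * mehler t a.1 a.2 * f a.1 * Complex.I_sq
  refine ⟨(iX.add iY).congr (ae_of_all _ key), ?_⟩
  rw [zero_smul, add_zero] at eX eY
  rw [complexGradient, eX, eY, mul_left_comm, ← mul_add, ← integral_const_mul, ← integral_add iX iY]
  simp_rw [key]

/-- The Mehler symbol minus its leading exponential terms at infinity. -/
noncomputable def remSymb (t r l : ℝ) : ℝ :=
  symb t r l - 2 * |l| * Real.exp (-(|l| * (t + r ^ 2 / 4)))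

lemma remSymb_abs (t r l : ℝ) : remSymb t r |l| = remSymb t r l := by
  simp [remSymb, symb_abs]

lemma remSymb_eq {t l : ℝ} (ht : 0 < t) (hl : 0 < l) (r : ℝ) :
    remSymb t r l = 2 * l * Real.exp (-(l * (t + r ^ 2 / 4))) *
      (Real.exp (-(r ^ 2 * l / 2 * (Real.exp (-(2 * (l * t))) / (1 - Real.exp (-(2 * (l * t)))))))
        * (1 + Real.exp (-(2 * (l * t))) / (1 - Real.exp (-(2 * (l * t))))) - 1) := by
  set q := Real.exp (-(2 * (l * t))) with hq
  have hq1 : q < 1 := Real.exp_lt_one_iff.2 (by nlinarith [mul_pos hl ht])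
  have hne : 1 - q ≠ 0 := by linarith
  set E := Real.exp (l * t) with hE
  have hE0 : 0 < E := Real.exp_pos _
  have e1 : Real.exp (-(l * t)) = q * E := by rw [hq, hE, ← Real.exp_add]; ring_nf
  have e2 : q * E * E = 1 := by rw [← e1, hE, ← Real.exp_add]; simp
  have hs : Real.sinh (l * t) = E * (1 - q) / 2 := by rw [Real.sinh_eq, e1]; ring
  have hc : Real.cosh (l * t) = E * (1 + q) / 2 := by rw [Real.cosh_eq, e1]; ring
  have hr : rate t l = l + 2 * l * (q / (1 - q)) := by
    rw [rate, hs, hc]; field_simp; ring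
  have ha : amp t l = 2 * l * Real.exp (-(l * t)) * (1 + q / (1 - q)) := by
    rw [amp, hs, e1]; field_simp; linear_combination -e2
  rw [remSymb, symb, ha, hr, abs_of_pos hl,
    show -(r ^ 2 / 4) * (l + 2 * l * (q / (1 - q))) =
      -(l * (r ^ 2 / 4)) + -(r ^ 2 * l / 2 * (q / (1 - q))) by ring,
    show -(l * (t + r ^ 2 / 4)) = -(l * t) + -(l * (r ^ 2 / 4)) by ring,
    Real.exp_add, Real.exp_add]
  ring

lemma abs_remSymb_le {t : ℝ} (ht : 0 < t) (r l : ℝ) :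
    |remSymb t r l| ≤ 2 * (1 + r ^ 2 / 2 * (|l| + 1 / t)) * (|l| + 1 / t) *
      Real.exp (-(|l| * (3 * t + r ^ 2 / 4))) := by
  rw [← remSymb_abs]
  rcases (abs_nonneg l).eq_or_lt with h | h
  · rw [← h]
    simp only [remSymb, symb, amp, abs_zero, mul_zero, zero_div, zero_mul, sub_zero]
    positivity
  generalize |l| = m at h ⊢
  rw [remSymb_eq ht h]
  have e0 : Real.exp (-(m * (3 * t + r ^ 2 / 4))) =
      Real.exp (-(m * (t + r ^ 2 / 4))) * Real.exp (-(2 * (m * t))) := by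
    rw [← Real.exp_add]; ring_nf
  have hmt := mul_pos h ht
  have hX : Real.exp (-(2 * (m * t))) * (1 + 2 * (m * t)) ≤ 1 := by
    have h1 := Real.add_one_le_exp (2 * (m * t))
    have h4 : Real.exp (-(2 * (m * t))) * Real.exp (2 * (m * t)) = 1 := by
      rw [← Real.exp_add]; simp
    nlinarith [Real.exp_pos (-(2 * (m * t)))]
  have hq1 : Real.exp (-(2 * (m * t))) < 1 := Real.exp_lt_one_iff.2 (by linarith)
  have hq0 := Real.exp_pos (-(2 * (m * t)))
  rw [e0]
  generalize Real.exp (-(2 * (m * t))) = q at hX hq1 hq0 ⊢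
  have hw0 : 0 ≤ q / (1 - q) := div_nonneg hq0.le (by linarith)
  have hmw : m * (q / (1 - q)) ≤ q * (m + 1 / t) := by
    rw [← mul_div_assoc, div_le_iff₀ (by linarith)]
    have : (m + 1 / t) * (1 - q) - m = (1 - q * (1 + m * t)) / t := by field_simp; ring
    have h2 : 0 ≤ (1 - q * (1 + m * t)) / t := div_nonneg (by nlinarith) ht.le
    nlinarith
  generalize q / (1 - q) = w at hw0 hmw ⊢
  have hs0 : 0 ≤ r ^ 2 * m / 2 := by positivity
  have ht' : 0 < 1 / t := by positivity
  have hsm : r ^ 2 * m / 2 ≤ r ^ 2 / 2 * (m + 1 / t) := by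
    nlinarith [mul_nonneg (sq_nonneg r) ht'.le]
  have hlow := Real.add_one_le_exp (-(r ^ 2 * m / 2 * w))
  have hup : Real.exp (-(r ^ 2 * m / 2 * w)) ≤ 1 :=
    Real.exp_le_one_iff.2 (by nlinarith [mul_nonneg hs0 hw0])
  have hpos := Real.exp_pos (-(r ^ 2 * m / 2 * w))
  generalize r ^ 2 * m / 2 = s at *
  generalize Real.exp (-(s * w)) = e at *
  have hbr : |e * (1 + w) - 1| ≤ (1 + s) * w := by
    rw [abs_le]; constructor <;> nlinarith [mul_nonneg hs0 hw0, mul_nonneg hpos.le hw0]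
  rw [abs_mul, abs_of_nonneg (by positivity)]
  have hE := Real.exp_pos (-(m * (t + r ^ 2 / 4)))
  generalize Real.exp (-(m * (t + r ^ 2 / 4))) = E at *
  calc 2 * m * E * |e * (1 + w) - 1| ≤ 2 * m * E * ((1 + s) * w) := by gcongr
    _ = 2 * E * (1 + s) * (m * w) := by ring
    _ ≤ 2 * E * (1 + r ^ 2 / 2 * (m + 1 / t)) * (q * (m + 1 / t)) := by gcongr
    _ = _ := by ring

lemma measurable_remSymb (t r : ℝ) : Measurable (remSymb t r) := by
  have := measurable_symb t r
  unfold remSymb; fun_prop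

lemma norm_exp_I_mul_le (l : ℝ) (w : ℂ) :
    ‖Complex.exp (Complex.I * l * w)‖ ≤ Real.exp (|l| * |w.im|) := by
  rw [Complex.norm_exp, Real.exp_le_exp, ← abs_mul]
  refine le_trans (le_of_eq ?_) (neg_le_abs (l * w.im))
  simp

lemma norm_exp_mul_remSymb_le {t : ℝ} (ht : 0 < t) (r l b : ℝ) {w : ℂ} (hw : |w.im| ≤ b) :
    ‖Complex.exp (Complex.I * l * w) * (remSymb t r l : ℂ)‖ ≤
      2 * (1 + r ^ 2 / 2 * (|l| + 1 / t)) * (|l| + 1 / t) *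
        Real.exp (-(|l| * (3 * t + r ^ 2 / 4 - b))) := by
  have h := (norm_exp_I_mul_le l w).trans
    (Real.exp_le_exp.2 (mul_le_mul_of_nonneg_left hw (abs_nonneg l)))
  rw [norm_mul, Complex.norm_real, Real.norm_eq_abs]
  refine (mul_le_mul h (abs_remSymb_le ht r l) (abs_nonneg _) (Real.exp_pos _).le).trans_eq ?_
  rw [show -(|l| * (3 * t + r ^ 2 / 4 - b)) = |l| * b + -(|l| * (3 * t + r ^ 2 / 4)) by ring,
    Real.exp_add]
  ring

lemma integrable_remSymb_bound (t r : ℝ) {d : ℝ} (hd : 0 < d) : Integrable fun l : ℝ =>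
    2 * (1 + r ^ 2 / 2 * (|l| + 1 / t)) * (|l| + 1 / t) * Real.exp (-(|l| * d)) := by
  convert! ((integrable_add_pow_mul_exp 1 (1 / t) hd).const_mul 2).add
    ((integrable_add_pow_mul_exp 2 (1 / t) hd).const_mul (r ^ 2)) using 2
  simp only [Pi.add_apply]; ring

lemma integrable_exp_mul_remSymb {t : ℝ} (ht : 0 < t) (r : ℝ) {w : ℂ} (hw : w ∈ strip t r) :
    Integrable fun l : ℝ => Complex.exp (Complex.I * l * w) * (remSymb t r l : ℂ) := by
  have := measurable_remSymb t r
  have hw' : |w.im| < r ^ 2 / 4 + 3 * t := hw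
  exact (integrable_remSymb_bound t r (d := 3 * t + r ^ 2 / 4 - |w.im|) (by linarith)).mono'
    (by fun_prop) (ae_of_all _ fun l => norm_exp_mul_remSymb_le ht r l _ le_rfl)

/-- The part of the heat kernel that is analytic in the whole strip. -/
noncomputable def remKernel (t r : ℝ) (w : ℂ) : ℂ :=
  ∫ l : ℝ, Complex.exp (Complex.I * l * w) * (remSymb t r l : ℂ)

lemma isOpen_strip (t r : ℝ) : IsOpen (strip t r) :=
  isOpen_lt (by fun_prop) continuous_const

lemma differentiableAt_remKernel {t : ℝ} (ht : 0 < t) (r : ℝ) {w : ℂ} (hw : w ∈ strip t r) :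
    DifferentiableAt ℂ (remKernel t r) w := by
  have hw' : |w.im| < r ^ 2 / 4 + 3 * t := hw
  obtain ⟨b, hb1, hb2⟩ := exists_between hw'
  have hm := measurable_remSymb t r
  have hd : 0 < 3 * t + r ^ 2 / 4 - b := by linarith
  have hbound : Integrable fun l : ℝ => (|l| + 1 / t) *
      (2 * (1 + r ^ 2 / 2 * (|l| + 1 / t)) * (|l| + 1 / t) *
        Real.exp (-(|l| * (3 * t + r ^ 2 / 4 - b)))) := by
    convert! ((integrable_add_pow_mul_exp 2 (1 / t) hd).const_mul 2).add
      ((integrable_add_pow_mul_exp 3 (1 / t) hd).const_mul (r ^ 2)) using 2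
    simp only [Pi.add_apply]; ring
  have hS : {w : ℂ | |w.im| < b} ∈ 𝓝 w :=
    (isOpen_lt (by fun_prop) continuous_const).mem_nhds hb1
  refine (hasDerivAt_integral_of_dominated_loc_of_deriv_le (𝕜 := ℂ) (s := {w : ℂ | |w.im| < b})
    (F := fun w (l : ℝ) => Complex.exp (Complex.I * l * w) * (remSymb t r l : ℂ))
    (F' := fun w (l : ℝ) => Complex.I * l * (Complex.exp (Complex.I * l * w) * (remSymb t r l : ℂ)))
    hS (Eventually.of_forall fun w => by fun_prop) (integrable_exp_mul_remSymb ht r hw)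
    (by fun_prop) (ae_of_all _ fun l v hv => ?_) hbound
    (ae_of_all _ fun l v _ => ?_)).2.differentiableAt
  · rw [norm_mul]
    have ht' : 0 < 1 / t := by positivity
    refine mul_le_mul ?_ (norm_exp_mul_remSymb_le ht r l b (le_of_lt hv)) (norm_nonneg _)
      (by positivity)
    simp
    positivity
  · have h1 : HasDerivAt (fun v : ℂ => Complex.exp (Complex.I * l * v))
        (Complex.exp (Complex.I * l * v) * (Complex.I * l * 1)) v :=
      ((hasDerivAt_id v).const_mul (Complex.I * l)).cexp
    convert! h1.mul_const (remSymb t r l : ℂ) using 1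
    ring

lemma analyticAt_remKernel {t : ℝ} (ht : 0 < t) (r : ℝ) {w : ℂ} (hw : w ∈ strip t r) :
    AnalyticAt ℂ (remKernel t r) w :=
  DifferentiableOn.analyticAt
    (fun _ hv => (differentiableAt_remKernel ht r hv).differentiableWithinAt)
    ((isOpen_strip t r).mem_nhds hw)

lemma norm_ofReal_mul_exp (c : ℂ) {l : ℝ} (hl : 0 ≤ l) :
    ‖(l : ℂ) * Complex.exp (-(c * l))‖ = |l| ^ 1 * Real.exp (-(|l| * c.re)) := by
  rw [norm_mul, Complex.norm_exp, Complex.norm_real, Real.norm_eq_abs, pow_one, abs_of_nonneg hl]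
  simp [mul_comm]

lemma integrableOn_mul_exp_Ioi {c : ℂ} (hc : 0 < c.re) :
    IntegrableOn (fun l : ℝ => (l : ℂ) * Complex.exp (-(c * l))) (Set.Ioi 0) := by
  refine (integrable_abs_pow_mul_exp 1 hc).integrableOn.mono' (by fun_prop) ?_
  filter_upwards [ae_restrict_mem measurableSet_Ioi] with l hl
  exact (norm_ofReal_mul_exp c (le_of_lt hl)).le

lemma integral_mul_exp_Ioi {c : ℂ} (hc : 0 < c.re) :
    ∫ l : ℝ in Set.Ioi 0, (l : ℂ) * Complex.exp (-(c * l)) = 1 / c ^ 2 := by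
  have hc0 : c ≠ 0 := by rintro rfl; simp at hc
  have h := integral_Ioi_of_hasDerivAt_of_tendsto' (a := (0 : ℝ)) (m := 0)
    (f := fun l : ℝ => -((l : ℂ) * Complex.exp (-(c * l)) / c + Complex.exp (-(c * l)) / c ^ 2))
    (f' := fun l : ℝ => (l : ℂ) * Complex.exp (-(c * l))) (fun l _ => ?_)
    (integrableOn_mul_exp_Ioi hc) ?_
  · rw [h]; simp
  · have h1 : HasDerivAt (fun l : ℝ => (l : ℂ)) 1 l := Complex.ofRealCLM.hasDerivAt
    have h2 := ((h1.const_mul c).neg).cexp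
    have h3 := (((h1.mul h2).div_const c).add (h2.div_const (c ^ 2))).neg
    convert! h3 using 1
    simp only [Pi.neg_apply]
    field_simp; ring
  · have g : ∀ n : ℕ, Tendsto (fun l : ℝ => l ^ n * Real.exp (-(c.re * l))) atTop (𝓝 0) := by
      intro n
      have := (Real.tendsto_pow_mul_exp_neg_atTop_nhds_zero n).comp
        (tendsto_id.const_mul_atTop hc)
      have := this.const_mul ((c.re ^ n)⁻¹)
      rw [mul_zero] at this
      refine this.congr fun l => ?_
      simp only [Function.comp_apply, id, mul_pow]
      field_simp
    have hn : ∀ l : ℝ, ‖Complex.exp (-(c * l))‖ = Real.exp (-(c.re * l)) := fun l => by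
      rw [Complex.norm_exp]; simp
    have t1 : Tendsto (fun l : ℝ => (l : ℂ) * Complex.exp (-(c * l))) atTop (𝓝 0) := by
      refine squeeze_zero_norm' ?_ (g 1)
      filter_upwards [eventually_ge_atTop 0] with l hl
      rw [norm_mul, hn, Complex.norm_real, Real.norm_of_nonneg hl, pow_one]
    have t0 : Tendsto (fun l : ℝ => Complex.exp (-(c * l))) atTop (𝓝 0) := by
      refine squeeze_zero_norm (fun l => ?_) (g 0)
      rw [hn, pow_zero, one_mul]
    simpa using ((t1.div_const c).add (t0.div_const (c ^ 2))).neg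

lemma exp_mul_abs_mul_exp_of_pos (a : ℝ) (w : ℂ) {l : ℝ} (hl : 0 < l) :
    Complex.exp (Complex.I * l * w) * ((2 * |l| * Real.exp (-(|l| * a)) : ℝ) : ℂ) =
      2 * ((l : ℂ) * Complex.exp (-((a - Complex.I * w) * l))) := by
  rw [abs_of_pos hl]
  push_cast
  rw [show -((a - Complex.I * w) * l) = Complex.I * l * w + -(l * a) by ring, Complex.exp_add]
  ring

lemma integral_exp_mul_abs_mul_exp {a : ℝ} (ha : 0 < a) (z : ℝ) :
    Integrable (fun l : ℝ => Complex.exp (Complex.I * l * z) *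
      ((2 * |l| * Real.exp (-(|l| * a)) : ℝ) : ℂ)) ∧
    ∫ l : ℝ, Complex.exp (Complex.I * l * z) * ((2 * |l| * Real.exp (-(|l| * a)) : ℝ) : ℂ) =
      2 / (a - Complex.I * z) ^ 2 + 2 / (a + Complex.I * z) ^ 2 := by
  set F : ℝ → ℂ := fun l =>
    Complex.exp (Complex.I * l * z) * ((2 * |l| * Real.exp (-(|l| * a)) : ℝ) : ℂ) with hF
  have hint : Integrable F := by
    refine ((integrable_abs_pow_mul_exp 1 ha).const_mul 2).mono' (by fun_prop)
      (ae_of_all _ fun l => le_of_eq ?_)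
    rw [norm_mul, norm_exp_I_mul, one_mul, Complex.norm_real, Real.norm_of_nonneg (by positivity)]
    ring
  refine ⟨hint, ?_⟩
  have hpos : ∫ l in Set.Ioi 0, F l = 2 / (a - Complex.I * z) ^ 2 := by
    rw [setIntegral_congr_fun measurableSet_Ioi
      (fun l hl => exp_mul_abs_mul_exp_of_pos a z hl), integral_const_mul,
      integral_mul_exp_Ioi (by simpa using ha)]
    ring
  have hneg : ∫ l in Set.Iic 0, F l = 2 / (a + Complex.I * z) ^ 2 := by
    have h1 := integral_comp_neg_Iic 0 (fun l => F (-l))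
    simp only [neg_neg, neg_zero] at h1
    rw [h1, setIntegral_congr_fun measurableSet_Ioi (g := fun l : ℝ =>
      2 * ((l : ℂ) * Complex.exp (-((a + Complex.I * z) * l)))) (fun l hl => ?_),
      integral_const_mul, integral_mul_exp_Ioi (by simpa using ha)]
    · ring
    · have := exp_mul_abs_mul_exp_of_pos a (-z) (l := l) hl
      simp only [hF, abs_neg]
      rw [show (a + Complex.I * z : ℂ) = a - Complex.I * -z by ring, ← this]
      push_cast; ring_nf
  rw [← integral_add_compl (measurableSet_Ioi (a := (0 : ℝ))) hint, Set.compl_Ioi, hpos, hneg]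

/-- The continuation of the heat kernel with one of the two poles removed. -/
noncomputable def starFun (t r : ℝ) (w : ℂ) : ℂ :=
  1 / (4 * (Real.pi : ℂ) ^ 2) * (1 / (((t + r ^ 2 / 4 : ℝ) : ℂ) - Complex.I * w) ^ 2) +
    1 / (8 * (Real.pi : ℂ) ^ 2) * remKernel t r w

lemma heatKernel_sub_poleTerm {t : ℝ} (ht : 0 < t) (r z : ℝ) :
    starFun t r z = heatKernel t r z - poleTerm t r z := by
  have ha : 0 < t + r ^ 2 / 4 := by positivity
  obtain ⟨hi, he⟩ := integral_exp_mul_abs_mul_exp ha z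
  have hrem : remKernel t r z = (∫ l : ℝ, Complex.exp (Complex.I * l * z) * (symb t r l : ℂ)) -
      ∫ l : ℝ, Complex.exp (Complex.I * l * z) *
        ((2 * |l| * Real.exp (-(|l| * (t + r ^ 2 / 4))) : ℝ) : ℂ) := by
    rw [← integral_sub (integrable_exp_mul_symb ht r z) hi, remKernel]
    congr 1; ext l
    rw [remSymb, Complex.ofReal_sub]; ring
  rw [starFun, hrem, he, heatKernel_eq, poleTerm]
  have : (t : ℂ) + Complex.I * z + (r : ℂ) ^ 2 / 4 =
    ((t + r ^ 2 / 4 : ℝ) : ℂ) + Complex.I * z := by push_cast; ring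
  rw [this, one_div_mul_eq_div]
  generalize t + r ^ 2 / 4 = a at ha ⊢
  have hp : (Real.pi : ℂ) ≠ 0 := by exact_mod_cast Real.pi_ne_zero
  have h1 : (a + Complex.I * z : ℂ) ≠ 0 := by
    intro h; have := congrArg Complex.re h; simp at this; linarith
  have h2 : (a - Complex.I * z : ℂ) ≠ 0 := by
    intro h; have := congrArg Complex.re h; simp at this; linarith
  generalize (a : ℂ) + Complex.I * z = A at h1 ⊢
  generalize (a : ℂ) - Complex.I * z = B at h2 ⊢
  generalize (∫ l : ℝ, Complex.exp (Complex.I * l * z) * (symb t r l : ℂ)) = J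
  field_simp
  ring

lemma sub_I_mul_ne_zero {t r : ℝ} {w : ℂ} (hw : w ∈ starDomain t r) :
    ((t + r ^ 2 / 4 : ℝ) : ℂ) - Complex.I * w ≠ 0 := by
  intro h
  refine hw.2 ?_
  rw [Set.mem_singleton_iff, sub_eq_zero.1 h, ← mul_assoc, Complex.I_mul_I]
  ring

lemma isStarKernel_starFun {t : ℝ} (ht : 0 < t) (r : ℝ) : IsStarKernel t r (starFun t r) where
  meromorphicOn w hw := by
    have h1 := (analyticAt_remKernel ht r hw).meromorphicAt
    have h2 : MeromorphicAt (fun w : ℂ => ((t + r ^ 2 / 4 : ℝ) : ℂ) - Complex.I * w) w :=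
      AnalyticAt.meromorphicAt (by fun_prop)
    exact (((MeromorphicAt.const _ _).mul ((MeromorphicAt.const 1 _).div (h2.pow 2)))).add
      ((MeromorphicAt.const _ _).mul h1)
  analyticOnNhd w hw := by
    have h1 := analyticAt_remKernel ht r hw.1
    have h2 : AnalyticAt ℂ (fun w : ℂ => ((t + r ^ 2 / 4 : ℝ) : ℂ) - Complex.I * w) w := by fun_prop
    exact (analyticAt_const.mul (analyticAt_const.div (h2.pow 2)
      (pow_ne_zero 2 (sub_I_mul_ne_zero hw)))).add (analyticAt_const.mul h1)
  eq_real z := heatKernel_sub_poleTerm ht r z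

lemma mem_starDomain_of_im {t r : ℝ} {w : ℂ} (h : |w.im| < r ^ 2 / 4 + 3 * t)
    (hne : w.re ≠ 0 ∨ w.im ≠ -(t + r ^ 2 / 4)) : w ∈ starDomain t r := by
  refine ⟨h, fun hw => ?_⟩
  rw [Set.mem_singleton_iff] at hw
  generalize t + r ^ 2 / 4 = a at hw hne
  rcases hne with h | h
  · apply h; rw [hw]; simp
  · apply h; rw [hw]; simp

lemma isPreconnected_starDomain {t : ℝ} (ht : 0 < t) (r : ℝ) :
    IsPreconnected (starDomain t r) := by
  have hr := sq_nonneg r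
  set a := t + r ^ 2 / 4 with ha
  have hstrip : Convex ℝ (strip t r) := by
    have : strip t r = {w : ℂ | w.im < r ^ 2 / 4 + 3 * t} ∩ {w | -(r ^ 2 / 4 + 3 * t) < w.im} := by
      ext w; simp only [strip, Set.mem_ofPred_eq, abs_lt, Set.mem_inter_iff]; tauto
    rw [this]
    exact (convex_halfSpace_im_lt _).inter (convex_halfSpace_im_gt _)
  have hA := (hstrip.inter (convex_halfSpace_re_gt 0)).isPreconnected
  have hB := (hstrip.inter (convex_halfSpace_re_lt 0)).isPreconnected
  have hC := (hstrip.inter (convex_halfSpace_im_gt (-a))).isPreconnected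
  have hD := (hstrip.inter (convex_halfSpace_im_lt (-a))).isPreconnected
  have hm : ∀ w : ℂ, w ∈ strip t r ↔ |w.im| < r ^ 2 / 4 + 3 * t := fun w => Iff.rfl
  have hAC := IsPreconnected.union (⟨1, 0⟩ : ℂ)
    (by exact ⟨by rw [hm]; simp; positivity, by simp⟩)
    (by exact ⟨by rw [hm]; simp; positivity, by simp; positivity⟩) hA hC
  have hACB := IsPreconnected.union (⟨-1, 0⟩ : ℂ)
    (by exact Or.inr ⟨by rw [hm]; simp; positivity, by simp; positivity⟩)
    (by exact ⟨by rw [hm]; simp; positivity, by simp⟩) hAC hB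
  have hlt : |-(a + t)| < r ^ 2 / 4 + 3 * t := by
    rw [abs_neg, abs_of_pos (by positivity)]; linarith
  have hall := IsPreconnected.union (⟨1, -(a + t)⟩ : ℂ)
    (by exact Or.inl (Or.inl ⟨hlt, by simp⟩)) (by exact ⟨hlt, by simp [ht]⟩) hACB hD
  convert hall using 1
  ext w
  constructor
  · rintro ⟨hw, hne⟩
    rcases lt_trichotomy w.re 0 with h | h | h
    · exact Or.inl (Or.inr ⟨hw, h⟩)
    · rcases lt_trichotomy w.im (-a) with h' | h' | h'
      · exact Or.inr ⟨hw, h'⟩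
      · rw [← ha] at hne
        exact (hne (Complex.ext (by simp [h]) (by simp [h']))).elim
      · exact Or.inl (Or.inl (Or.inr ⟨hw, h'⟩))
    · exact Or.inl (Or.inl (Or.inl ⟨hw, h⟩))
  · rintro (((h | h) | h) | h)
    · exact mem_starDomain_of_im h.1 (Or.inl (ne_of_gt h.2))
    · exact mem_starDomain_of_im h.1 (Or.inr (ne_of_gt h.2))
    · exact mem_starDomain_of_im h.1 (Or.inl (ne_of_lt h.2))
    · exact mem_starDomain_of_im h.1 (Or.inr (ne_of_lt h.2))

lemma IsStarKernel.eqOn {t r : ℝ} (ht : 0 < t) {G H : ℂ → ℂ} (hG : IsStarKernel t r G)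
    (hH : IsStarKernel t r H) : Set.EqOn G H (starDomain t r) := by
  have h0 : (0 : ℂ) ∈ starDomain t r := by
    refine mem_starDomain_of_im (by simp; positivity) (Or.inr ?_)
    have : 0 < t + r ^ 2 / 4 := by positivity
    simp only [Complex.zero_im]
    linarith
  refine hG.analyticOnNhd.eqOn_of_preconnected_of_frequently_eq hH.analyticOnNhd
    (isPreconnected_starDomain ht r) h0 ?_
  have htend : Tendsto (fun s : ℝ => (s : ℂ)) (𝓝[≠] 0) (𝓝[≠] 0) := by
    refine tendsto_nhdsWithin_iff.2 ⟨?_, ?_⟩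
    · exact (Complex.continuous_ofReal.tendsto' 0 0 Complex.ofReal_zero).mono_left
        nhdsWithin_le_nhds
    · filter_upwards [self_mem_nhdsWithin] with s hs
      simpa using hs
  refine htend.frequently (Eventually.frequently (Eventually.of_forall fun s => ?_))
  rw [hG.eq_real, hH.eq_real]

lemma isStarKernel_starKernel {t : ℝ} (ht : 0 < t) (r : ℝ) :
    IsStarKernel t r (starKernel t r) := by
  have h : ∃ G : ℂ → ℂ, IsStarKernel t r G := ⟨_, isStarKernel_starFun ht r⟩
  rw [starKernel, dif_pos h]
  exact h.choose_spec

lemma integral_smul_fderiv_eq_zero {G : Heis → ℂ} (hG : ContDiff ℝ 1 G) (hGc : HasCompactSupport G)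
    {c : Heis → ℝ} (hc : Differentiable ℝ c) {v : Heis} (hcv : ∀ q, fderiv ℝ c q v = 0) :
    ∫ q, c q • fderiv ℝ G q v = 0 := by
  have : (volume : Measure Heis).IsAddHaarMeasure := Measure.prod.instIsAddHaarMeasure
    (volume : Measure ℝ) (volume : Measure (ℝ × ℝ))
  have hc' := hc.continuous
  have hG' := hG.continuous
  have hd : Continuous fun q => fderiv ℝ G q v :=
    (hG.continuous_fderiv one_ne_zero).clm_apply continuous_const
  have hdc : HasCompactSupport fun q => fderiv ℝ G q v := hGc.fderiv_apply ℝ v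
  rw [integral_smul_fderiv_eq_neg_fderiv_smul_of_integrable]
  · simp [hcv]
  · simp [hcv]
  · exact (hc'.smul hd).integrable_of_hasCompactSupport hdc.smul_left
  · exact (hc'.smul hG').integrable_of_hasCompactSupport hGc.smul_left
  · exact fun q _ => hc q
  · exact fun q _ => hG.differentiable one_ne_zero q

lemma integral_fderiv_field {G : Heis → ℂ} (hG : ContDiff ℝ 1 G) (hGc : HasCompactSupport G)
    {c : Heis → ℝ} (hc : Differentiable ℝ c) {v w : Heis} (hcw : ∀ q, fderiv ℝ c q w = 0) :
    Integrable (fun q => fderiv ℝ G q (v + c q • w)) ∧ ∫ q, fderiv ℝ G q (v + c q • w) = 0 := by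
  have hd : ∀ v : Heis, Continuous fun q => fderiv ℝ G q v := fun v =>
    (hG.continuous_fderiv one_ne_zero).clm_apply continuous_const
  have hdc : ∀ v : Heis, HasCompactSupport fun q => fderiv ℝ G q v := fun v =>
    hGc.fderiv_apply ℝ v
  have i1 : Integrable fun q => fderiv ℝ G q v := (hd v).integrable_of_hasCompactSupport (hdc v)
  have i2 : Integrable fun q => c q • fderiv ℝ G q w :=
    (hc.continuous.smul (hd w)).integrable_of_hasCompactSupport (hdc w).smul_left
  have h1 := integral_smul_fderiv_eq_zero hG hGc (c := fun _ => (1 : ℝ)) (v := v)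
    (differentiable_const _) (by simp)
  simp only [one_smul] at h1
  simp only [map_add, map_smul]
  exact ⟨i1.add i2, by rw [integral_add i1 i2, h1, integral_smul_fderiv_eq_zero hG hGc hc hcw,
    add_zero]⟩

lemma dirX_eq (q : Heis) : dirX q = (1, 0, 0) + (-(y q) / 2) • ((0, 0, 1) : Heis) := by
  simp [dirX]

lemma dirY_eq (q : Heis) : dirY q = (0, 1, 0) + (x q / 2) • ((0, 0, 1) : Heis) := by
  simp [dirY]

lemma hasFDerivAt_x (q : Heis) : HasFDerivAt x (ContinuousLinearMap.fst ℝ ℝ (ℝ × ℝ)) q :=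
  hasFDerivAt_fst

lemma hasFDerivAt_y (q : Heis) : HasFDerivAt y
    ((ContinuousLinearMap.fst ℝ ℝ ℝ).comp (ContinuousLinearMap.snd ℝ ℝ (ℝ × ℝ))) q :=
  ((ContinuousLinearMap.fst ℝ ℝ ℝ).comp (ContinuousLinearMap.snd ℝ ℝ (ℝ × ℝ))).hasFDerivAt

lemma integral_fderiv_dirX {G : Heis → ℂ} (hG : ContDiff ℝ 1 G) (hGc : HasCompactSupport G) :
    Integrable (fun q => fderiv ℝ G q (dirX q)) ∧ ∫ q, fderiv ℝ G q (dirX q) = 0 := by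
  simp_rw [dirX_eq]
  have h : ∀ q, HasFDerivAt (fun q => -(y q) / 2) _ q := fun q =>
    (hasFDerivAt_y q).neg.mul_const (2⁻¹ : ℝ)
  refine integral_fderiv_field hG hGc (c := fun q => -(y q) / 2)
    (fun q => (h q).differentiableAt) (fun q => ?_)
  rw [(h q).fderiv]
  simp

lemma integral_fderiv_dirY {G : Heis → ℂ} (hG : ContDiff ℝ 1 G) (hGc : HasCompactSupport G) :
    Integrable (fun q => fderiv ℝ G q (dirY q)) ∧ ∫ q, fderiv ℝ G q (dirY q) = 0 := by
  simp_rw [dirY_eq]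
  have h : ∀ q, HasFDerivAt (fun q => x q / 2) _ q := fun q =>
    (hasFDerivAt_x q).mul_const (2⁻¹ : ℝ)
  refine integral_fderiv_field hG hGc (c := fun q => x q / 2)
    (fun q => (h q).differentiableAt) (fun q => ?_)
  rw [(h q).fderiv]
  simp

/-- The product of a character of the centre and a Gaussian. -/
noncomputable def gaussChar (l c : ℝ) (q : Heis) : ℂ :=
  Complex.exp (Complex.I * l * z q - c / 4 * (x q ^ 2 + y q ^ 2))

lemma contDiff_gaussChar {n : WithTop ℕ∞} (l c : ℝ) : ContDiff ℝ n (gaussChar l c) := by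
  have hx : ContDiff ℝ n fun q : Heis => (x q : ℂ) := Complex.ofRealCLM.contDiff.comp contDiff_x
  have hy : ContDiff ℝ n fun q : Heis => (y q : ℂ) := Complex.ofRealCLM.contDiff.comp contDiff_y
  have hz : ContDiff ℝ n fun q : Heis => (z q : ℂ) := Complex.ofRealCLM.contDiff.comp contDiff_z
  unfold gaussChar
  fun_prop

lemma hasDerivAt_comp_line_complex {G : Heis → ℂ} (hG : Differentiable ℝ G) (p v : Heis) :
    HasDerivAt (fun s : ℝ => G (p + s • v)) (fderiv ℝ G p v) 0 := by
  have h : HasDerivAt (fun s : ℝ => p + s • v) v 0 := by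
    simpa using ((hasDerivAt_id (0 : ℝ)).smul_const v).const_add p
  have h2 : HasFDerivAt G (fderiv ℝ G p) (p + (0 : ℝ) • v) := by simpa using (hG p).hasFDerivAt
  exact h2.comp_hasDerivAt 0 h

lemma fderiv_gaussChar (l c : ℝ) (q v : Heis) : fderiv ℝ (gaussChar l c) q v =
    (Complex.I * l * z v - c / 2 * (x q * x v + y q * y v)) * gaussChar l c q := by
  have h1 := hasDerivAt_comp_line_complex
    ((contDiff_gaussChar (n := 1) l c).differentiable one_ne_zero) q v
  have hs : HasDerivAt (fun s : ℝ => (s : ℂ)) 1 0 := Complex.ofRealCLM.hasDerivAt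
  have hx : HasDerivAt (fun s : ℝ => (x q + s * x v : ℂ)) (1 * x v) 0 :=
    (hs.mul_const _).const_add _
  have hy : HasDerivAt (fun s : ℝ => (y q + s * y v : ℂ)) (1 * y v) 0 :=
    (hs.mul_const _).const_add _
  have hz : HasDerivAt (fun s : ℝ => (z q + s * z v : ℂ)) (1 * z v) 0 :=
    (hs.mul_const _).const_add _
  have h2 := ((hz.const_mul (Complex.I * l)).sub
    (((hx.pow 2).add (hy.pow 2)).const_mul (c / 4 : ℂ))).cexp
  have e : (fun s : ℝ => gaussChar l c (q + s • v)) = fun s : ℝ => Complex.exp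
      (Complex.I * l * (z q + s * z v) - c / 4 * ((x q + s * x v) ^ 2 + (y q + s * y v) ^ 2)) := by
    ext s
    simp only [gaussChar, x, y, z]
    simp
  rw [e] at h1
  refine (h1.unique h2).trans ?_
  simp only [gaussChar, Pi.add_apply, Pi.sub_apply, Pi.pow_apply]
  push_cast
  simp only [zero_mul, add_zero]
  ring

lemma fderiv_ofReal_comp {f : Heis → ℝ} (hf : Differentiable ℝ f) (q v : Heis) :
    fderiv ℝ (fun q => (f q : ℂ)) q v = (fderiv ℝ f q v : ℂ) := by
  have : HasFDerivAt (fun q => (f q : ℂ)) (Complex.ofRealCLM.comp (fderiv ℝ f q)) q :=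
    Complex.ofRealCLM.hasFDerivAt.comp q (hf q).hasFDerivAt
  rw [this.fderiv]; rfl

lemma continuous_complexGradient {f : Heis → ℝ} (hf : ContDiff ℝ 1 f) :
    Continuous (complexGradient f) := by
  have h1 := (contDiff_fieldX (m := 0) hf (by simp)).continuous
  have h2 := (contDiff_fieldY (m := 0) hf (by simp)).continuous
  unfold complexGradient
  fun_prop

lemma hasCompactSupport_complexGradient {f : Heis → ℝ} (hfc : HasCompactSupport f) :
    HasCompactSupport (complexGradient f) := by
  refine (hfc.fderiv (𝕜 := ℝ)).mono fun q hq h => hq ?_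
  simp [complexGradient, fieldX, fieldY, h]

lemma integral_gaussChar_mul_complexGradient {f : Heis → ℝ} (hf : ContDiff ℝ 1 f)
    (hfc : HasCompactSupport f) (l c : ℝ) :
    ∫ q, gaussChar l c q * complexGradient f q =
      ∫ q, (x q + Complex.I * y q) * ((l + c) / 2) * gaussChar l c q * (f q : ℂ) := by
  set E := gaussChar l c with hE
  have hEd : ContDiff ℝ 1 E := contDiff_gaussChar l c
  have hfC : ContDiff ℝ 1 fun q => (f q : ℂ) := Complex.ofRealCLM.contDiff.comp hf
  have hfCc : HasCompactSupport fun q => (f q : ℂ) :=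
    hfc.comp_left (g := fun r : ℝ => (r : ℂ)) Complex.ofReal_zero
  have hG : ContDiff ℝ 1 fun q => E q * (f q : ℂ) := hEd.mul hfC
  have hGc : HasCompactSupport fun q => E q * (f q : ℂ) := hfCc.mul_left
  have hd : ∀ q v, fderiv ℝ (fun q => E q * (f q : ℂ)) q v =
      E q * (fderiv ℝ f q v : ℂ) +
      (Complex.I * l * z v - c / 2 * (x q * x v + y q * y v)) * E q * (f q : ℂ) := by
    intro q v
    have := ((hEd.differentiable one_ne_zero q).hasFDerivAt.mul
      (hfC.differentiable one_ne_zero q).hasFDerivAt).fderiv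
    have h2 := congrArg (fun T : Heis →L[ℝ] ℂ => T v) this
    refine h2.trans ?_
    simp only [add_apply, smul_apply, smul_eq_mul,
      fderiv_ofReal_comp (hf.differentiable one_ne_zero)]
    rw [hE, fderiv_gaussChar]
    ring
  obtain ⟨iX, eX⟩ := integral_fderiv_dirX hG hGc
  obtain ⟨iY, eY⟩ := integral_fderiv_dirY hG hGc
  have hx := continuous_x
  have hy := continuous_y
  have hEc := hEd.continuous
  have hfc' := hf.continuous
  have i1 : Integrable fun q => E q * complexGradient f q :=
    (hEc.mul (continuous_complexGradient hf)).integrable_of_hasCompactSupport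
      (hasCompactSupport_complexGradient hfc).mul_left
  have i2 : Integrable fun q => (x q + Complex.I * y q) * ((l + c) / 2) * E q * (f q : ℂ) :=
    Continuous.integrable_of_hasCompactSupport (by fun_prop) hfCc.mul_left
  rw [← sub_eq_zero, ← integral_sub i1 i2]
  have e : (fun q => E q * complexGradient f q -
      (x q + Complex.I * y q) * ((l + c) / 2) * E q * (f q : ℂ)) = fun q =>
      fderiv ℝ (fun q => E q * (f q : ℂ)) q (dirX q) +
      Complex.I * fderiv ℝ (fun q => E q * (f q : ℂ)) q (dirY q) := by
    ext q
    have hX : fieldX f q = fderiv ℝ f q (dirX q) := rfl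
    have hY : fieldY f q = fderiv ℝ f q (dirY q) := rfl
    rw [hd, hd, complexGradient, hX, hY]
    simp only [dirX, dirY, x, y, z]
    push_cast
    linear_combination -(l : ℂ) * q.1 / 2 * E q * f q * Complex.I_sq
  rw [e, integral_add iX (iY.const_mul _), integral_const_mul, eX, eY]
  simp

/-- The symbol of the star kernel along the shifted line. -/
noncomputable def starSymb (t r l : ℝ) : ℝ :=
  Real.exp (-2 * l * t) * if 0 < l then symb t r l else remSymb t r l

lemma abs_starSymb_le {t : ℝ} (ht : 0 < t) (r l : ℝ) : |starSymb t r l| ≤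
    2 * (1 + r ^ 2 / 2 * (|l| + 1 / t)) * (|l| + 1 / t) * Real.exp (-(|l| * t)) := by
  have hc : 0 < |l| + 1 / t := by positivity
  rw [starSymb, abs_mul, Real.abs_exp]
  split_ifs with hl
  · rw [abs_of_nonneg (symb_nonneg ht r l)]
    calc _ ≤ 1 * (2 * (|l| + 1 / t) * Real.exp (-(|l| * t))) := by
          gcongr
          · exact symb_nonneg ht r l
          · exact Real.exp_le_one_iff.2 (by nlinarith [mul_pos hl ht])
          · exact (symb_le_amp ht r l).trans (amp_le' ht l)
      _ = 2 * 1 * (|l| + 1 / t) * Real.exp (-(|l| * t)) := by ring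
      _ ≤ _ := by
          gcongr
          have : 0 ≤ r ^ 2 / 2 * (|l| + 1 / t) := by positivity
          linarith
  · have hl' : -2 * l * t = 2 * |l| * t := by rw [abs_of_nonpos (not_lt.1 hl)]; ring
    calc _ ≤ Real.exp (-2 * l * t) * (2 * (1 + r ^ 2 / 2 * (|l| + 1 / t)) * (|l| + 1 / t) *
            Real.exp (-(|l| * (3 * t + r ^ 2 / 4)))) := by
          gcongr
          exact abs_remSymb_le ht r l
      _ = 2 * (1 + r ^ 2 / 2 * (|l| + 1 / t)) * (|l| + 1 / t) *
            Real.exp (-(|l| * t) - |l| * (r ^ 2 / 4)) := by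
          rw [hl', mul_left_comm, ← Real.exp_add]; ring_nf
      _ ≤ _ := by
          gcongr
          have : 0 ≤ |l| * (r ^ 2 / 4) := by positivity
          linarith

lemma add_two_I_mem_starDomain {t : ℝ} (ht : 0 < t) (r z : ℝ) :
    ((z : ℂ) + 2 * Complex.I * t) ∈ starDomain t r := by
  have him : ((z : ℂ) + 2 * Complex.I * t).im = 2 * t := by simp
  have := sq_nonneg r
  refine mem_starDomain_of_im ?_ (Or.inr ?_) <;> rw [him]
  · rw [abs_of_pos (by positivity)]; linarith
  · linarith

lemma starKernel_shift {t : ℝ} (ht : 0 < t) (r z : ℝ) :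
    starKernel t r ((z : ℂ) + 2 * Complex.I * t) = 1 / (8 * (Real.pi : ℂ) ^ 2) *
      ∫ l : ℝ, Complex.exp (Complex.I * l * z) * (starSymb t r l : ℂ) := by
  have hmem := add_two_I_mem_starDomain ht r z
  rw [(isStarKernel_starKernel ht r).eqOn ht (isStarKernel_starFun ht r) hmem, starFun]
  set w : ℂ := (z : ℂ) + 2 * Complex.I * t with hw
  set a : ℝ := t + r ^ 2 / 4 with ha
  have hre : 0 < ((a : ℂ) - Complex.I * w).re := by
    have : ((a : ℂ) - Complex.I * w).re = a + 2 * t := by simp [hw]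
    rw [this]; positivity
  have h1 : 1 / ((a : ℂ) - Complex.I * w) ^ 2 = 2⁻¹ * ∫ l : ℝ, (Set.Ioi (0 : ℝ)).indicator
      (fun l : ℝ => 2 * ((l : ℂ) * Complex.exp (-((a - Complex.I * w) * l)))) l := by
    rw [integral_indicator measurableSet_Ioi, integral_const_mul, integral_mul_exp_Ioi hre]
    ring
  have hi : Integrable ((Set.Ioi (0 : ℝ)).indicator
      (fun l : ℝ => 2 * ((l : ℂ) * Complex.exp (-((a - Complex.I * w) * l))))) :=
    (integrable_indicator_iff measurableSet_Ioi).2 ((integrableOn_mul_exp_Ioi hre).const_mul 2)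
  have e : (∫ l : ℝ, Complex.exp (Complex.I * l * z) * (starSymb t r l : ℂ)) =
      (∫ l : ℝ, (Set.Ioi (0 : ℝ)).indicator
        (fun l : ℝ => 2 * ((l : ℂ) * Complex.exp (-((a - Complex.I * w) * l)))) l) +
      remKernel t r w := by
    rw [remKernel, ← integral_add hi (integrable_exp_mul_remSymb ht r hmem.1)]
    congr 1; ext l
    have hexp : Complex.exp (Complex.I * l * w) =
        Complex.exp (Complex.I * l * z) * Complex.exp (-2 * l * t) := by
      rw [← Complex.exp_add, hw]
      congr 1
      linear_combination 2 * (l : ℂ) * t * Complex.I_sq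
    rw [starSymb]
    by_cases hl : 0 < l
    · rw [if_pos hl, Set.indicator_of_mem (Set.mem_Ioi.2 hl),
        ← exp_mul_abs_mul_exp_of_pos a w hl, remSymb, hexp, ← ha]
      push_cast; ring
    · rw [if_neg hl, Set.indicator_of_notMem (by simpa using hl), hexp]
      push_cast; ring
  rw [h1, e]
  ring

lemma starKernel_shift_mul {t : ℝ} (ht : 0 < t) (r z : ℝ) (w : ℂ) :
    starKernel t r ((z : ℂ) + 2 * Complex.I * t) * w = 1 / (8 * (Real.pi : ℂ) ^ 2) *
      ∫ l : ℝ, Complex.exp (Complex.I * l * z) * (starSymb t r l : ℂ) * w := by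
  rw [starKernel_shift ht, integral_mul_const, mul_assoc]

lemma measurable_radius_snd_symb (t : ℝ) :
    Measurable fun a : Heis × ℝ => symb t (radius a.1) a.2 := by
  have h1 := measurable_amp_snd t
  have h2 := measurable_rate_snd t
  have h3 : Measurable fun a : Heis × ℝ => radius a.1 :=
    continuous_radius.measurable.comp measurable_fst
  unfold symb; fun_prop

lemma measurable_starSymb_prod (t : ℝ) :
    Measurable fun a : Heis × ℝ => starSymb t (radius a.1) a.2 := by
  have h1 := measurable_radius_snd_symb t
  have h3 : Measurable fun a : Heis × ℝ => radius a.1 :=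
    continuous_radius.measurable.comp measurable_fst
  unfold starSymb remSymb
  refine Measurable.mul (by fun_prop) (Measurable.ite ?_ h1 (by fun_prop))
  exact measurableSet_lt measurable_const measurable_snd

lemma integrable_starSymb_mul {t : ℝ} (ht : 0 < t) {g : Heis → ℂ} (hg : Continuous g)
    (hgc : HasCompactSupport g) : Integrable fun a : Heis × ℝ =>
      Complex.exp (Complex.I * a.2 * z a.1) * (starSymb t (radius a.1) a.2 : ℂ) * g a.1 := by
  obtain ⟨M, hM⟩ := exists_abs_le_of_tsupport hgc continuous_radius
  have hm := measurable_starSymb_prod t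
  have hz : Measurable fun a : Heis × ℝ => z a.1 := continuous_z.measurable.comp measurable_fst
  refine integrable_mul_of_bound (Φ := fun a : Heis × ℝ =>
      Complex.exp (Complex.I * a.2 * z a.1) * (starSymb t (radius a.1) a.2 : ℂ)) hg hgc
    (integrable_remSymb_bound t M ht) (Measurable.aestronglyMeasurable (by fun_prop))
    fun q hq l _ => ?_
  rw [norm_mul, norm_exp_I_mul, one_mul, Complex.norm_real, Real.norm_eq_abs]
  refine (abs_starSymb_le ht _ _).trans ?_
  have h2 : radius q ^ 2 ≤ M ^ 2 := by
    rw [← sq_abs (radius q)]; gcongr; exact hM q hq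
  gcongr

lemma integral_starSymb_mul_complexGradient {f : Heis → ℝ} (hf : ContDiff ℝ 1 f)
    (hfc : HasCompactSupport f) {t l : ℝ} (ht : 0 < t) (hl : l ≠ 0) :
    ∫ q, Complex.exp (Complex.I * l * z q) * (starSymb t (radius q) l : ℂ) *
      complexGradient f q =
    ∫ q, (x q + Complex.I * y q) * ((rate t l - l) / 2) * mehler t q l * (f q : ℂ) := by
  have hmeh : ∀ q, mehler t q l = amp t l * gaussChar l (rate t l) q := fun q => mehler_eq t q l
  have hshift : ((l + rate t l) * Real.exp (-2 * l * t) : ℂ) = rate t l - l := by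
    exact_mod_cast congrArg (fun s : ℝ => (s : ℂ)) (rate_shift ht.ne' hl)
  have hexp : ∀ q, Complex.exp (Complex.I * l * z q) * (symb t (radius q) l : ℂ) =
      amp t l * gaussChar l (rate t l) q := fun q => by rw [← hmeh, mehler]
  have hmain : ∫ q, amp t l * Real.exp (-2 * l * t) *
      (gaussChar l (rate t l) q * complexGradient f q) =
      ∫ q, (x q + Complex.I * y q) * ((rate t l - l) / 2) * mehler t q l * (f q : ℂ) := by
    rw [integral_const_mul, integral_gaussChar_mul_complexGradient hf hfc, ← integral_const_mul]
    congr 1; ext q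
    rw [hmeh, ← hshift]; ring
  rw [← hmain]
  rcases lt_or_gt_of_ne hl with h | h
  · have hEc := (contDiff_gaussChar (n := 1) l (rate t l)).continuous
    have hEc' := (contDiff_gaussChar (n := 1) l (-l)).continuous
    have hg := continuous_complexGradient hf
    have hgc := hasCompactSupport_complexGradient hfc
    have i1 : Integrable fun q => gaussChar l (rate t l) q * complexGradient f q :=
      (hEc.mul hg).integrable_of_hasCompactSupport hgc.mul_left
    have i2 : Integrable fun q => gaussChar l (-l) q * complexGradient f q :=
      (hEc'.mul hg).integrable_of_hasCompactSupport hgc.mul_left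
    have hzero : ∫ q, gaussChar l (-l) q * complexGradient f q = 0 := by
      rw [integral_gaussChar_mul_complexGradient hf hfc]
      simp
    have e : ∀ q, Complex.exp (Complex.I * l * z q) * (starSymb t (radius q) l : ℂ) *
        complexGradient f q = amp t l * Real.exp (-2 * l * t) *
        (gaussChar l (rate t l) q * complexGradient f q) -
        (Real.exp (-2 * l * t) * (2 * |l|) * Real.exp (-(|l| * t)) : ℝ) *
        (gaussChar l (-l) q * complexGradient f q) := by
      intro q
      have h2 : Complex.exp (Complex.I * l * z q) *
          (Real.exp (-(|l| * (t + radius q ^ 2 / 4))) : ℂ) =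
          Real.exp (-(|l| * t)) * gaussChar l (-l) q := by
        rw [gaussChar, abs_of_neg h, radius_sq, Complex.ofReal_exp, Complex.ofReal_exp,
          ← Complex.exp_add, ← Complex.exp_add]
        congr 1; push_cast; ring
      rw [starSymb, if_neg h.not_gt, remSymb]
      push_cast at h2 ⊢
      linear_combination Complex.exp (-2 * l * t) * complexGradient f q * hexp q -
        Complex.exp (-2 * l * t) * (2 * (|l| : ℝ)) * complexGradient f q * h2
    simp_rw [e]
    rw [integral_sub (i1.const_mul _) (i2.const_mul _), integral_const_mul _
      (fun q => gaussChar l (-l) q * complexGradient f q), hzero, mul_zero, sub_zero]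
  · congr 1; ext q
    rw [starSymb, if_pos h]
    push_cast
    linear_combination Complex.exp (-2 * l * t) * complexGradient f q * hexp q

theorem integrable_starKernel_mul_complexGradient {f : Heis → ℝ} (hf : ContDiff ℝ 1 f)
    (hfc : HasCompactSupport f) {t : ℝ} (ht : 0 < t) : Integrable fun p : Heis =>
      starKernel t (radius p) ((z p : ℂ) + 2 * Complex.I * (t : ℂ)) * complexGradient f p := by
  simp_rw [starKernel_shift_mul ht]
  exact (integrable_starSymb_mul ht (continuous_complexGradient hf)
    (hasCompactSupport_complexGradient hfc)).integral_prod_left.const_mul _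

theorem complexGradient_heatSemigroup_zero {f : Heis → ℝ} (hf : ContDiff ℝ 2 f)
    (hfc : HasCompactSupport f) {t : ℝ} (ht : 0 < t) :
    complexGradient (heatSemigroup t f) 0 = ∫ p : Heis,
      starKernel t (radius p) ((z p : ℂ) + 2 * Complex.I * (t : ℂ)) * complexGradient f p := by
  have hf1 : ContDiff ℝ 1 f := hf.of_le (by norm_num)
  have hi := integrable_starSymb_mul ht (continuous_complexGradient hf1)
    (hasCompactSupport_complexGradient hfc)
  obtain ⟨hj, e⟩ := complexGradient_flow_zero hf hfc ht
  have e1 := integral_integral_swap (μ := (volume : Measure Heis)) (ν := (volume : Measure ℝ))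
    (f := fun q l => Complex.exp (Complex.I * l * z q) * (starSymb t (radius q) l : ℂ) *
      complexGradient f q) hi
  have e3 : ∫ a : Heis × ℝ, (x a.1 + Complex.I * y a.1) * ((rate t a.2 - a.2) / 2) *
      mehler t a.1 a.2 * (f a.1 : ℂ) = ∫ l : ℝ, ∫ q : Heis,
      (x q + Complex.I * y q) * ((rate t l - l) / 2) * mehler t q l * (f q : ℂ) :=
    integral_prod_symm _ hj
  have e4 : ∫ p : Heis, starKernel t (radius p) ((z p : ℂ) + 2 * Complex.I * (t : ℂ)) *
      complexGradient f p = 1 / (8 * (Real.pi : ℂ) ^ 2) * ∫ q : Heis, ∫ l : ℝ,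
      Complex.exp (Complex.I * l * z q) * (starSymb t (radius q) l : ℂ) *
      complexGradient f q := by
    rw [← integral_const_mul]
    simp only [starKernel_shift_mul ht]
  rw [heatSemigroup_eq_flow hf hfc ht.le, e, e4, e1, e3]
  congr 1
  refine integral_congr_ae ?_
  filter_upwards [ae_ne_zero] with l hl
  exact (integral_starSymb_mul_complexGradient hf1 hfc ht hl).symm

end Heis

theorem mainTheorem11 (f : Heis → ℝ) (hf : ContDiff ℝ ∞ f) (hfc : HasCompactSupport f) :
    -- `t ↦ P_t f` is the unique bounded solution of the heat equation issued from `f`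
    Heis.IsHeatFlow f (fun t => Heis.heatSemigroup t f) ∧
    (∀ u : ℝ → Heis → ℝ, Heis.IsHeatFlow f u →
      ∀ t : ℝ, 0 ≤ t → u t = Heis.heatSemigroup t f) ∧
    ∀ t : ℝ, 0 < t →
      -- `p_t` is the density of `P_t` at the origin
      ((Heis.heatSemigroup t f 0 : ℝ) : ℂ) =
        ∫ p : Heis, Heis.heatKernel t (Heis.radius p) (Heis.z p) * (f p : ℂ) ∧
      -- `p*_t(r, ·)` exists and is unique
      (∀ r : ℝ, 0 ≤ r →
        Heis.IsStarKernel t r (Heis.starKernel t r) ∧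
        ∀ G : ℂ → ℂ, Heis.IsStarKernel t r G →
          Set.EqOn G (Heis.starKernel t r) (Heis.starDomain t r)) ∧
      -- the commutation formula
      MeasureTheory.Integrable (fun p : Heis =>
        Heis.starKernel t (Heis.radius p) ((Heis.z p : ℂ) + 2 * Complex.I * (t : ℂ)) *
          Heis.complexGradient f p) ∧
      Heis.complexGradient (Heis.heatSemigroup t f) 0 =
        ∫ p : Heis,
          Heis.starKernel t (Heis.radius p) ((Heis.z p : ℂ) + 2 * Complex.I * (t : ℂ)) *
            Heis.complexGradient f p := by
  have hf2 : ContDiff ℝ 2 f := by exact_mod_cast contDiff_infty.1 hf 2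
  have hf1 : ContDiff ℝ 1 f := hf2.of_le (by norm_num)
  have hflow := Heis.isHeatFlow_heatSemigroup hf2 hfc
  refine ⟨hflow, fun u hu t ht => hu.unique hflow ht, fun t ht =>
    ⟨Heis.ofReal_heatSemigroup_zero hf2 hfc ht, fun r _ => ?_,
      Heis.integrable_starKernel_mul_complexGradient hf1 hfc ht,
      Heis.complexGradient_heatSemigroup_zero hf2 hfc ht⟩⟩
  have hstar := Heis.isStarKernel_starKernel ht r
  exact ⟨hstar, fun G hG => hG.eqOn ht hstar⟩
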